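/- Let $0<q<1$ and $\tau\in\mathbb R$. Let $A_q(SU(2))$ be the universal unital $C^*$-algebra generated by $\alpha,\gamma$ subject to $$\alpha\gamma=q\gamma\alpha,\quad \alpha\gamma^*=q\gamma^*\alpha,\quad \gamma\gamma^*=\gamma^*\gamma,\quad \alpha^*\alpha+\gamma^*\gamma=1=\alpha\alpha^*+q^2\gamma\gamma^*,$$ with the comultiplication $\Delta:A_q(SU(2))\to A_q(SU(2))\otimes A_q(SU(2))$ (the $C^*$-tensor product), the unital $*$-homomorphism with $\Delta(\alpha)=\alpha\otimes\alpha-q\gamma^*\otimes\gamma$ and $\Delta(\gamma)=\gamma\otimes\alpha+\alpha^*\otimes\gamma$. There is exactly one bounded linear functional $h$ on $A_q(SU(2))$, the Haar functional, such that $h(1)=1$ and $(\mathrm{id}\otimes h)\Delta(a)=h(a)1=(h\otimes \mathrm{id})\Delta(a)$ for all $a\in A_q(SU(2))$. Put $$\rho_{\tau,\infty}=iq^\tau(\alpha^*\gamma-\gamma^*\alpha)-(1-q^{2\tau})\gamma^*\gamma,\qquad X=\{-q^{2k}: k\ge 0\}\cup\{q^{2\tau+2k}: k\ge 0\}\cup\{0\},$$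 with $k$ ranging over the non-negative integers. Then $\rho_{\tau,\infty}$ is self-adjoint with spectrum $X$, the unital $C^*$-subalgebra generated by $\rho_{\tau,\infty}$ consists of the elements $p(\rho_{\tau,\infty})$ (continuous functional calculus) with $p:X\to\mathbb C$ continuous, and for every such $p$ $$h\bigl(p(\rho_{\tau,\infty})\bigr)=\frac{1}{1+q^{2\tau}}\int_{-1}^{q^{2\tau}}p(x)\,d_{q^2}x .$$ Here, for $0<r<1$, $\int_0^b f(x)\,d_rx=(1-r)\,b\sum_{k=0}^\infty f(br^k)r^k$ and $\int_a^b f(x)\,d_rx=\int_0^b f(x)\,d_rx-\int_0^a f(x)\,d_rx$, and the series involved for $f=p$ converge absolutely. -/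

import Mathlib

open scoped ENNReal BoundedContinuousFunction

noncomputable section

/-! ### The defining relations -/

/-- The defining relations of the quantum group `SU_q(2)` for a pair `(a, c)` in the role of
`(α, γ)`. -/
structure SUqRel {B : Type*} [Ring B] [StarRing B] [Algebra ℂ B] (q : ℝ) (a c : B) : Prop where
  ac : a * c = (q : ℂ) • (c * a)
  ac' : a * star c = (q : ℂ) • (star c * a)
  cc' : c * star c = star c * c
  sphere : star a * a + star c * c = 1
  sphere' : a * star a + (q : ℂ) ^ 2 • (c * star c) = 1

/-- The *-subalgebra generated by `a₁, c₁` commutes with the one generated by `a₂, c₂`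
(the remaining commutation relations are the adjoints of the ones listed). -/
structure SUqComm {B : Type*} [Ring B] [StarRing B] (a₁ c₁ a₂ c₂ : B) : Prop where
  aa : Commute a₁ a₂
  aa' : Commute a₁ (star a₂)
  ac : Commute a₁ c₂
  ac' : Commute a₁ (star c₂)
  ca : Commute c₁ a₂
  ca' : Commute c₁ (star a₂)
  cc : Commute c₁ c₂
  cc' : Commute c₁ (star c₂)

/-- If two *-commuting pairs satisfy the relations, so does their "matrix product". -/
theorem SUqRel.mul {B : Type*} [Ring B] [StarRing B] [Algebra ℂ B] [StarModule ℂ B] {q : ℝ}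
    {a₁ c₁ a₂ c₂ : B} (h₁ : SUqRel q a₁ c₁) (h₂ : SUqRel q a₂ c₂) (h : SUqComm a₁ c₁ a₂ c₂) :
    SUqRel q (a₁ * a₂ - (q : ℂ) • (star c₁ * c₂)) (c₁ * a₂ + star a₁ * c₂) := by
  have e1 : star a₂ * star a₁ = star a₁ * star a₂ := h.aa.star_star.eq.symm
  have e2 : star c₂ * star a₁ = star a₁ * star c₂ := h.ac.star_star.eq.symm
  have e3 : star a₂ * star c₁ = star c₁ * star a₂ := h.ca.star_star.eq.symm
  have e4 : star c₂ * star c₁ = star c₁ * star c₂ := h.cc.star_star.eq.symm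
  have f1 : a₂ * star a₁ = star a₁ * a₂ := by simpa using congrArg star h.aa'.eq
  have f2 : c₂ * star a₁ = star a₁ * c₂ := by simpa using congrArg star h.ac'.eq
  have f3 : a₂ * star c₁ = star c₁ * a₂ := by simpa using congrArg star h.ca'.eq
  have f4 : c₂ * star c₁ = star c₁ * c₂ := by simpa using congrArg star h.cc'.eq
  have g1 : star c₂ * c₁ = c₁ * star c₂ := h.cc'.eq.symm
  have g2 : star a₂ * c₁ = c₁ * star a₂ := h.ca'.eq.symm
  have hq : star (q : ℂ) = q := Complex.conj_ofReal q
  have key : ∀ x₁ x₂ y₁ y₂ : B, x₂ * y₁ = y₁ * x₂ →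
      (x₁ * x₂) * (y₁ * y₂) = (x₁ * y₁) * (x₂ * y₂) := fun x₁ x₂ y₁ y₂ hh => by
    rw [mul_assoc, ← mul_assoc x₂, hh, mul_assoc, mul_assoc]
  have r₁ : star c₁ * star a₁ = (q : ℂ) • (star a₁ * star c₁) := by
    simpa [hq] using congrArg star h₁.ac
  have r₂' : c₂ * star a₂ = (q : ℂ) • (star a₂ * c₂) := by simpa [hq] using congrArg star h₂.ac'
  have s₁ := eq_sub_of_add_eq h₁.sphere
  have s₁' := eq_sub_of_add_eq h₁.sphere'
  have s₂ := eq_sub_of_add_eq h₂.sphere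
  have s₂' := eq_sub_of_add_eq h₂.sphere'
  constructor <;>
  simp only [star_sub, star_add, star_mul, star_star, star_smul, hq, e1, e3, g1, h.ac'.eq.symm,
    mul_add, add_mul, mul_sub, sub_mul, smul_mul_assoc, mul_smul_comm,
    key _ _ _ _ e1, key _ _ _ _ e2, key _ _ _ _ e3, key _ _ _ _ e4,
    key _ _ _ _ f1, key _ _ _ _ f2, key _ _ _ _ f3, key _ _ _ _ f4, key _ _ _ _ g1, key _ _ _ _ g2,
    key _ _ _ _ h.aa.eq.symm, key _ _ _ _ h.ac.eq.symm, key _ _ _ _ h.ca.eq.symm,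
    key _ _ _ _ h.cc.eq.symm, key _ _ _ _ h.aa'.eq.symm, key _ _ _ _ h.ac'.eq.symm,
    r₁, r₂', s₁, s₁', s₂, s₂', h₁.ac, h₁.ac', h₂.ac, h₂.ac', h₁.cc', h₂.cc', one_mul, mul_one] <;>
  module

/-! ### The universal C*-algebra

A separable unital C*-algebra has a faithful unital representation on `ℓ²(ℕ)`, so the universal
unital C*-algebra on finitely many generators and relations is realised inside the bounded
functions from the set of all representations of the relations on `ℓ²(ℕ)` to `B(ℓ²(ℕ))`:
it is the closed unital *-subalgebra generated by the tautological functions. In particular its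
norm is the supremum of the operator norms over all representations. -/

/-- Bounded operators on `ℓ²(ℕ)`. -/
abbrev BOp : Type := lp (fun _ : ℕ => ℂ) 2 →L[ℂ] lp (fun _ : ℕ => ℂ) 2

/-- The C*-algebra of bounded functions from the (discrete) set `I` to `B(ℓ²(ℕ))`, with pointwise
operations and supremum norm. -/
def BFun (I : Type) [TopologicalSpace I] : Type := I →ᵇ BOp

instance (I : Type) [TopologicalSpace I] : CStarAlgebra (BFun I) :=
  inferInstanceAs (CStarAlgebra (I →ᵇ BOp))

instance (I : Type) [TopologicalSpace I] : CoeFun (BFun I) fun _ => I → BOp :=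
  ⟨fun x => (show I →ᵇ BOp from x)⟩

theorem BFun.ext {I : Type} [TopologicalSpace I] {x y : BFun I} (h : ∀ i, x i = y i) : x = y :=
  BoundedContinuousFunction.ext h

/-- A representation of the relations on `ℓ²(ℕ)`. -/
structure SUqPair (q : ℝ) : Type where
  a : BOp
  c : BOp
  rel : SUqRel q a c

/-- A pair of commuting representations of the relations on `ℓ²(ℕ)`. -/
structure SUqCommPair (q : ℝ) : Type where
  fst : SUqPair q
  snd : SUqPair q
  comm : SUqComm fst.a fst.c snd.a snd.c

instance (q : ℝ) : TopologicalSpace (SUqPair q) := ⊥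
instance (q : ℝ) : DiscreteTopology (SUqPair q) := ⟨rfl⟩
instance (q : ℝ) : TopologicalSpace (SUqCommPair q) := ⊥
instance (q : ℝ) : DiscreteTopology (SUqCommPair q) := ⟨rfl⟩

theorem norm_le_one_of_sphere {a c : BOp} (h : star a * a + star c * c = 1) :
    ‖a‖ ≤ 1 ∧ ‖c‖ ≤ 1 := by
  have key : ∀ x, ‖a x‖ ^ 2 + ‖c x‖ ^ 2 = ‖x‖ ^ 2 := fun x => by
    have h1 := congrArg (fun T : BOp => (inner ℂ (T x) x : ℂ)) h
    simp only [add_apply, inner_add_left, ContinuousLinearMap.star_eq_adjoint,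
      mul_apply_eq_comp, ContinuousLinearMap.adjoint_inner_left,
      one_apply_eq_self, inner_self_eq_norm_sq_to_K] at h1
    exact_mod_cast h1
  constructor <;> refine ContinuousLinearMap.opNorm_le_bound _ zero_le_one fun x => ?_ <;>
    rw [one_mul] <;> refine le_of_sq_le_sq ?_ (norm_nonneg x) <;> have := key x
  · nlinarith [sq_nonneg ‖c x‖]
  · nlinarith [sq_nonneg ‖a x‖]

theorem SUqPair.norm_a_le {q : ℝ} (i : SUqPair q) : ‖i.a‖ ≤ 1 :=
  (norm_le_one_of_sphere i.rel.sphere).1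

theorem SUqPair.norm_c_le {q : ℝ} (i : SUqPair q) : ‖i.c‖ ≤ 1 :=
  (norm_le_one_of_sphere i.rel.sphere).2

/-- The tautological generator `α`. -/
def genAlpha (q : ℝ) : BFun (SUqPair q) :=
  BoundedContinuousFunction.ofNormedAddCommGroupDiscrete (fun i => i.a) 1 SUqPair.norm_a_le

/-- The tautological generator `γ`. -/
def genGamma (q : ℝ) : BFun (SUqPair q) :=
  BoundedContinuousFunction.ofNormedAddCommGroupDiscrete (fun i => i.c) 1 SUqPair.norm_c_le

/-- The C*-algebra `A_q(SU(2))`: the universal unital C*-algebra generated by `α`, `γ` subject to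
the relations `SUqRel`. -/
def SUqAlg (q : ℝ) : StarSubalgebra ℂ (BFun (SUqPair q)) :=
  (StarAlgebra.adjoin ℂ {genAlpha q, genGamma q}).topologicalClosure

instance (q : ℝ) : IsClosed (SUqAlg q : Set (BFun (SUqPair q))) :=
  StarSubalgebra.isClosed_topologicalClosure _

/-- The type of elements of `A_q(SU(2))`. -/
abbrev ASU (q : ℝ) : Type := SUqAlg q

theorem genAlpha_mem (q : ℝ) : genAlpha q ∈ SUqAlg q :=
  StarSubalgebra.le_topologicalClosure _ (StarAlgebra.subset_adjoin ℂ _ (Set.mem_insert _ _))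

theorem genGamma_mem (q : ℝ) : genGamma q ∈ SUqAlg q :=
  StarSubalgebra.le_topologicalClosure _
    (StarAlgebra.subset_adjoin ℂ _ (Set.mem_insert_of_mem _ rfl))

/-- The generator `α` of `A_q(SU(2))`. -/
def suqAlpha (q : ℝ) : ASU q := ⟨genAlpha q, genAlpha_mem q⟩

/-- The generator `γ` of `A_q(SU(2))`. -/
def suqGamma (q : ℝ) : ASU q := ⟨genGamma q, genGamma_mem q⟩

theorem suq_rel (q : ℝ) : SUqRel q (suqAlpha q) (suqGamma q) := by
  constructor <;> refine Subtype.ext (BFun.ext fun i => ?_)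
  exacts [i.rel.ac, i.rel.ac', i.rel.cc', i.rel.sphere, i.rel.sphere']

/-! ### The C*-tensor square and the comultiplication -/

/-- Reindexing of bounded functions on discrete spaces, as a *-homomorphism. -/
def reindex {I J : Type} [TopologicalSpace I] [DiscreteTopology I] [TopologicalSpace J]
    (f : I → J) : BFun J →⋆ₐ[ℂ] BFun I where
  toFun x := BoundedContinuousFunction.compContinuous x ⟨f, continuous_of_discreteTopology⟩
  map_one' := rfl
  map_mul' _ _ := rfl
  map_zero' := rfl
  map_add' _ _ := rfl
  commutes' _ := rfl
  map_star' _ := rfl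

theorem continuous_reindex {I J : Type} [TopologicalSpace I] [DiscreteTopology I]
    [TopologicalSpace J] (f : I → J) : Continuous (reindex f : BFun J → BFun I) :=
  BoundedContinuousFunction.continuous_compContinuous
    (⟨f, continuous_of_discreteTopology⟩ : C(I, J))

/-- The C*-tensor product `A_q(SU(2)) ⊗ A_q(SU(2))`: the universal unital C*-algebra generated by
two commuting copies of `A_q(SU(2))`, i.e. the maximal C*-tensor product (`A_q(SU(2))` is of type I,
so all C*-tensor products coincide). -/
def SUqTensor (q : ℝ) : StarSubalgebra ℂ (BFun (SUqCommPair q)) :=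
  (StarAlgebra.adjoin ℂ
    {reindex SUqCommPair.fst (genAlpha q), reindex SUqCommPair.fst (genGamma q),
      reindex SUqCommPair.snd (genAlpha q), reindex SUqCommPair.snd (genGamma q)}).topologicalClosure

instance (q : ℝ) : IsClosed (SUqTensor q : Set (BFun (SUqCommPair q))) :=
  StarSubalgebra.isClosed_topologicalClosure _

/-- The type of elements of `A_q(SU(2)) ⊗ A_q(SU(2))`. -/
abbrev ASUTensor (q : ℝ) : Type := SUqTensor q

theorem SUqAlg_le_comap {q : ℝ} (f : SUqCommPair q → SUqPair q)
    (ha : reindex f (genAlpha q) ∈ SUqTensor q) (hc : reindex f (genGamma q) ∈ SUqTensor q) :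
    SUqAlg q ≤ (SUqTensor q).comap (reindex f) := by
  refine StarSubalgebra.topologicalClosure_minimal ?_ ?_
  · refine StarAlgebra.adjoin_le ?_
    rintro x (rfl | rfl)
    exacts [ha, hc]
  · exact (StarSubalgebra.isClosed_topologicalClosure _).preimage (continuous_reindex f)

theorem tensor_fst_alpha (q : ℝ) : reindex SUqCommPair.fst (genAlpha q) ∈ SUqTensor q :=
  StarSubalgebra.le_topologicalClosure _ (StarAlgebra.subset_adjoin ℂ _ (by simp))
theorem tensor_fst_gamma (q : ℝ) : reindex SUqCommPair.fst (genGamma q) ∈ SUqTensor q :=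
  StarSubalgebra.le_topologicalClosure _ (StarAlgebra.subset_adjoin ℂ _ (by simp))
theorem tensor_snd_alpha (q : ℝ) : reindex SUqCommPair.snd (genAlpha q) ∈ SUqTensor q :=
  StarSubalgebra.le_topologicalClosure _ (StarAlgebra.subset_adjoin ℂ _ (by simp))
theorem tensor_snd_gamma (q : ℝ) : reindex SUqCommPair.snd (genGamma q) ∈ SUqTensor q :=
  StarSubalgebra.le_topologicalClosure _ (StarAlgebra.subset_adjoin ℂ _ (by simp))

/-- Composition with a map of representations, as a *-homomorphism into the tensor square. -/
def liftTensor {q : ℝ} (f : SUqCommPair q → SUqPair q)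
    (ha : reindex f (genAlpha q) ∈ SUqTensor q) (hc : reindex f (genGamma q) ∈ SUqTensor q) :
    ASU q →⋆ₐ[ℂ] ASUTensor q :=
  ((reindex f).comp (SUqAlg q).subtype).codRestrict (SUqTensor q)
    fun x => SUqAlg_le_comap f ha hc x.2

/-- The embedding `a ↦ a ⊗ 1`. -/
def inLeft (q : ℝ) : ASU q →⋆ₐ[ℂ] ASUTensor q :=
  liftTensor SUqCommPair.fst (tensor_fst_alpha q) (tensor_fst_gamma q)

/-- The embedding `b ↦ 1 ⊗ b`. -/
def inRight (q : ℝ) : ASU q →⋆ₐ[ℂ] ASUTensor q :=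
  liftTensor SUqCommPair.snd (tensor_snd_alpha q) (tensor_snd_gamma q)

/-- The elementary tensor `a ⊗ b`. -/
def tmulSU {q : ℝ} (a b : ASU q) : ASUTensor q := inLeft q a * inRight q b

/-- The product of two commuting representations. -/
def SUqCommPair.prod {q : ℝ} (j : SUqCommPair q) : SUqPair q where
  a := j.fst.a * j.snd.a - (q : ℂ) • (star j.fst.c * j.snd.c)
  c := j.fst.c * j.snd.a + star j.fst.a * j.snd.c
  rel := j.fst.rel.mul j.snd.rel j.comm

theorem prod_alpha_eq (q : ℝ) : reindex SUqCommPair.prod (genAlpha q) =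
    (tmulSU (suqAlpha q) (suqAlpha q) -
      (q : ℂ) • tmulSU (star (suqGamma q)) (suqGamma q) : ASUTensor q) := rfl

theorem prod_gamma_eq (q : ℝ) : reindex SUqCommPair.prod (genGamma q) =
    (tmulSU (suqGamma q) (suqAlpha q) +
      tmulSU (star (suqAlpha q)) (suqGamma q) : ASUTensor q) := rfl

/-- The comultiplication `Δ : A_q(SU(2)) → A_q(SU(2)) ⊗ A_q(SU(2))`, the *-homomorphism with
`Δ α = α ⊗ α - q γ* ⊗ γ` and `Δ γ = γ ⊗ α + α* ⊗ γ` (see `comult_alpha`, `comult_gamma`). -/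
def comult (q : ℝ) : ASU q →⋆ₐ[ℂ] ASUTensor q :=
  liftTensor SUqCommPair.prod (prod_alpha_eq q ▸ Subtype.property _)
    (prod_gamma_eq q ▸ Subtype.property _)

theorem comult_alpha (q : ℝ) : comult q (suqAlpha q) =
    tmulSU (suqAlpha q) (suqAlpha q) - (q : ℂ) • tmulSU (star (suqGamma q)) (suqGamma q) := rfl

theorem comult_gamma (q : ℝ) : comult q (suqGamma q) =
    tmulSU (suqGamma q) (suqAlpha q) + tmulSU (star (suqAlpha q)) (suqGamma q) := rfl

/-! ### The Haar functional -/

/-- `S` is the slice map `id ⊗ h`; it is unique, as elementary tensors span a dense subspace. -/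
def IsSliceRight {q : ℝ} (h : ASU q →L[ℂ] ℂ) (S : ASUTensor q →L[ℂ] ASU q) : Prop :=
  ∀ a b, S (tmulSU a b) = h b • a

/-- `S` is the slice map `h ⊗ id`; it is unique, as elementary tensors span a dense subspace. -/
def IsSliceLeft {q : ℝ} (h : ASU q →L[ℂ] ℂ) (S : ASUTensor q →L[ℂ] ASU q) : Prop :=
  ∀ a b, S (tmulSU a b) = h a • b

/-- `h` is a Haar functional: `h(1) = 1` and `(id ⊗ h)Δ(a) = h(a)1 = (h ⊗ id)Δ(a)` for all `a`. -/
structure IsHaarFunctional (q : ℝ) (h : ASU q →L[ℂ] ℂ) : Prop where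
  map_one : h 1 = 1
  right_inv : ∃ S, IsSliceRight h S ∧ ∀ a, S (comult q a) = h a • (1 : ASU q)
  left_inv : ∃ S, IsSliceLeft h S ∧ ∀ a, S (comult q a) = h a • (1 : ASU q)

/-! ### The spherical element and the q-integral -/

/-- `ρ_{τ,∞} = i q^τ (α*γ - γ*α) - (1 - q^{2τ}) γ*γ`. -/
def rhoInf (q τ : ℝ) : ASU q :=
  (Complex.I * ((q ^ τ : ℝ) : ℂ)) •
      (star (suqAlpha q) * suqGamma q - star (suqGamma q) * suqAlpha q)
    - ((1 - q ^ (2 * τ) : ℝ) : ℂ) • (star (suqGamma q) * suqGamma q)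

/-- The set `{-q^{2k}} ∪ {q^{2τ+2k}} ∪ {0}`, `k = 0, 1, 2, …`. -/
def rhoSet (q τ : ℝ) : Set ℝ :=
  Set.range (fun k : ℕ => -q ^ (2 * k)) ∪ Set.range (fun k : ℕ => q ^ (2 * τ + 2 * (k : ℝ))) ∪ {0}

/-- `p(x)` for a complex valued function `p` on the real line and a self-adjoint element `x`
of `A_q(SU(2))`, through the continuous functional calculus. -/
def funcAt {q : ℝ} (p : ℝ → ℂ) (x : ASU q) : ASU q := cfc (fun z : ℂ => p z.re) x

/-- The q-integral `∫_0^b f(x) d_q x = (1 - q) b ∑_k f(b q^k) q^k`. -/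
def qIntegralZero (q b : ℝ) (f : ℝ → ℂ) : ℂ :=
  (1 - q) * b * ∑' k : ℕ, f (b * q ^ k) * (q : ℂ) ^ k

/-- The q-integral `∫_a^b f(x) d_q x = ∫_0^b f(x) d_q x - ∫_0^a f(x) d_q x`. -/
def qIntegral (q a b : ℝ) (f : ℝ → ℂ) : ℂ := qIntegralZero q b f - qIntegralZero q a f

/-- Absolute convergence of the two series in `∫_a^b f(x) d_q x`. -/
def QIntegrable (q a b : ℝ) (f : ℝ → ℂ) : Prop :=
  Summable (fun k : ℕ => f (a * q ^ k) * (q : ℂ) ^ k) ∧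
    Summable (fun k : ℕ => f (b * q ^ k) * (q : ℂ) ^ k)

end

set_option linter.unusedSectionVars false
set_option linter.unusedSimpArgs false

noncomputable section

/-! Write `e_k = γ^k α^(m-k)`. The monomials `e e'⋆`, with `e`, `e'` of this kind (possibly of
different degrees), span a dense subspace (`dense_monomialSpan`), so bounded functionals are
determined by their values there.

Existence of the Haar functional. In the regular representation put `h(x) = (1-q²) ∑ q^(2n)
⟨e_(n,0), x e_(n,0)⟩`. On monomials this vanishes off the diagonal and gives the q-beta values
`haarWeight` on it (`haar_monomial`). The comultiplication acts by `Δ e_k = ∑ u_kj ⊗ e_j`, so right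
invariance becomes row orthogonality of the matrix `u` for these weights (`matCoeff_orthogonal`),
proved by induction on the degree from the defining row recursion and a second, column recursion.
The automorphism `α ↦ α`, `γ ↦ -γ⋆` reverses the comultiplication, so it carries `h` to a left
invariant functional. A normalized right invariant functional equals any normalized left invariant
one (`eq_of_left_right_inv`), which gives both two-sided invariance and uniqueness.

Values on polynomials. Let `w = i s` with `s = q^τ`, and let `ρ_w` be `spherElt`. With `ξ_j = α +
q^j w γ`, the intertwining relations between `ρ_w` and `ρ_(qw)` give `(ξ₁⋯ξₘ)(ξ₁⋯ξₘ)⋆ = ∏_{j=1}^m (1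
+ q^(2j) ρ_w)`. Expanding `ξ₁⋯ξₘ` in the `e_k`, orthogonality and the q-binomial theorem evaluate
`h` on this product (`haar_aeval_qPoch`); the q-integral of the same polynomial telescopes
(`qIntegralZero_qPoch`). The two agree, and these products span all polynomials. Weierstrass
approximation extends the formula to continuous functions (`haar_funcAt`).

Spectrum. Positivity of `1 + ρ_w` and `s² - ρ_w` confines the spectrum to `[-1, s²]`. Exchanging
`b⋆b` and `bb⋆` twice shows that a spectral point other than `-1` and `s²` stays spectral after
division by `q²`; since the spectrum is bounded, only the asserted points can occur. Conversely each
nonzero asserted point carries positive mass in the q-integral, so it cannot be missed by the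
spectrum, and `0` is a limit of such points. -/

/-! ### Matrix coefficients -/

/-- The shift of a sequence, with value `0` at `0`. -/
def seqShift {B : Type*} [Zero B] (f : ℕ → B) : ℕ → B
  | 0 => 0
  | j + 1 => f j

theorem seqShift_zero {B : Type*} [Zero B] (f : ℕ → B) : seqShift f 0 = 0 := rfl

theorem seqShift_succ {B : Type*} [Zero B] (f : ℕ → B) (j : ℕ) : seqShift f (j + 1) = f j := rfl

theorem seqShift_const_zero {B : Type*} [Zero B] (j : ℕ) : seqShift (fun _ => (0 : B)) j = 0 := by
  cases j <;> rfl

/-- The matrix coefficients of the corepresentation of degree `m`: in terms of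
`e_k = γ ^ k * α ^ (m - k)` one has `Δ e_k = ∑ j, u m k j ⊗ e_j`. -/
def matCoeff {B : Type*} [Ring B] [StarRing B] [Algebra ℂ B] (q : ℝ) (a c : B) : ℕ → ℕ → ℕ → B
  | 0, k, j => if k = 0 ∧ j = 0 then 1 else 0
  | m + 1, 0, j => ((q : ℂ) ^ j) • (a * matCoeff q a c m 0 j) -
      (q : ℂ) • (star c * seqShift (matCoeff q a c m 0) j)
  | m + 1, k + 1, j => ((q : ℂ) ^ j) • (c * matCoeff q a c m k j) +
      star a * seqShift (matCoeff q a c m k) j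

namespace SUqRel

variable {B : Type*} [Ring B] [StarRing B] [Algebra ℂ B] [StarModule ℂ B] {q : ℝ} {a c : B}

theorem a_c_mul (h : SUqRel q a c) (x : B) : a * (c * x) = (q : ℂ) • (c * (a * x)) := by
  rw [← mul_assoc, h.ac, smul_mul_assoc, mul_assoc]

theorem a_c'_mul (h : SUqRel q a c) (x : B) :
    a * (star c * x) = (q : ℂ) • (star c * (a * x)) := by
  rw [← mul_assoc, h.ac', smul_mul_assoc, mul_assoc]

theorem c'_a' (h : SUqRel q a c) : star c * star a = (q : ℂ) • (star a * star c) := by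
  simpa [star_smul] using congrArg star h.ac

theorem c_a' (h : SUqRel q a c) : c * star a = (q : ℂ) • (star a * c) := by
  simpa [star_smul] using congrArg star h.ac'

theorem c_a'_mul (h : SUqRel q a c) (x : B) :
    c * (star a * x) = (q : ℂ) • (star a * (c * x)) := by
  rw [← mul_assoc, h.c_a', smul_mul_assoc, mul_assoc]

theorem c'_a'_mul (h : SUqRel q a c) (x : B) :
    star c * (star a * x) = (q : ℂ) • (star a * (star c * x)) := by
  rw [← mul_assoc, h.c'_a', smul_mul_assoc, mul_assoc]

theorem c'_c_mul (h : SUqRel q a c) (x : B) : star c * (c * x) = c * (star c * x) := by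
  rw [← mul_assoc, ← h.cc', mul_assoc]

theorem a'_a (h : SUqRel q a c) : star a * a = 1 - c * star c := by
  rw [h.cc', ← h.sphere]; abel

theorem a'_a_mul (h : SUqRel q a c) (x : B) : star a * (a * x) = x - c * (star c * x) := by
  rw [← mul_assoc, h.a'_a, sub_mul, one_mul, mul_assoc]

theorem a_a' (h : SUqRel q a c) : a * star a = 1 - (q : ℂ) ^ 2 • (c * star c) :=
  eq_sub_of_add_eq h.sphere'

theorem a_a'_mul (h : SUqRel q a c) (x : B) :
    a * (star a * x) = x - (q : ℂ) ^ 2 • (c * (star c * x)) := by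
  rw [← mul_assoc, h.a_a', sub_mul, one_mul, smul_mul_assoc, mul_assoc]

/-- Because `α γ^k = q^k γ^k α`, expanding `Δ(α e_k)` yields a second recursion, valid in every row
and not only in row `0`. The induction checks algebraically that it is compatible with the recursion
by `γ` which defines the rows `k + 1`. -/
theorem matCoeff_alpha (h : SUqRel q a c) (m k j : ℕ) (hk : k ≤ m) :
    (q : ℂ) ^ k • matCoeff q a c (m + 1) k j = ((q : ℂ) ^ j) • (a * matCoeff q a c m k j) -
      (q : ℂ) • (star c * seqShift (matCoeff q a c m k) j) := by
  induction m generalizing k j with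
  | zero =>
    obtain rfl : k = 0 := by omega
    simp [matCoeff]
  | succ m ih =>
    cases k with
    | zero => simp [matCoeff]
    | succ k =>
      have h1 := congrArg (c * ·) (ih k j (by omega))
      rw [matCoeff]
      rcases j with _ | _ | j
      · simp only [seqShift_zero, seqShift_succ, matCoeff, mul_add, mul_sub, mul_smul_comm, smul_sub, smul_add,
          h.a_c_mul, mul_zero, smul_zero, add_zero, sub_zero, pow_zero, one_smul] at h1 ⊢
        linear_combination (norm := module) (q : ℂ) • h1
      · have h2 := congrArg (star a * ·) (ih k 0 (by omega))
        simp only [seqShift_zero, seqShift_succ, matCoeff, mul_add, mul_sub, mul_smul_comm, smul_sub, smul_add,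
          h.a_c_mul, mul_zero, smul_zero, add_zero, sub_zero, pow_zero, one_smul, h.a_a'_mul,
          h.a'_a_mul, h.c'_c_mul, zero_add, pow_one] at h1 h2 ⊢
        linear_combination (norm := module) (q : ℂ) ^ 2 • h1 + (q : ℂ) • h2
      · have h2 := congrArg (star a * ·) (ih k (j + 1) (by omega))
        simp only [seqShift_zero, seqShift_succ, matCoeff, mul_add, mul_sub, mul_smul_comm, smul_sub, smul_add,
          h.a_c_mul, h.a_a'_mul, h.c'_a'_mul,
          h.a'_a_mul, h.c'_c_mul] at h1 h2 ⊢
        linear_combination (norm := module) (q : ℂ) ^ (j + 3) • h1 + (q : ℂ) • h2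

end SUqRel

/-! ### Column recursions for the matrix coefficients. -/

namespace SUqRel

variable {B : Type*} [Ring B] [StarRing B] [Algebra ℂ B] [StarModule ℂ B] {q : ℝ} {a c : B}

/-- A transposed recursion: it stays in column `j` and mixes rows `k` and `k - 1`, like a
q-derivative in `α`. The factors `q^(2j) - q^(2m+2)` and `q^(2k) - q^(2m+2)` are, up to powers of
`q`, the q-numbers of the exponents of `α` in `e_j` and `e_k`; `1 - q^(2k)` is that of the exponent
of `γ`. -/
theorem matCoeff_column_alpha (h : SUqRel q a c) (m k j : ℕ) (hk : k ≤ m + 1) :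
    (((q : ℂ) ^ (2 * j) - (q : ℂ) ^ (2 * m + 2)) * (q : ℂ) ^ k) • matCoeff q a c (m + 1) k j =
      (q : ℂ) ^ j • (((q : ℂ) ^ (2 * k) - (q : ℂ) ^ (2 * m + 2)) • (a * matCoeff q a c m k j) +
        ((q : ℂ) ^ k * (1 - (q : ℂ) ^ (2 * k))) •
          (c * seqShift (fun i => matCoeff q a c m i j) k)) := by
  induction m generalizing k j with
  | zero =>
    rcases (show k = 0 ∨ k = 1 by omega) with rfl | rfl <;> rcases j with _ | _ | j <;>
      simp [matCoeff, seqShift, pow_succ, mul_comm]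
  | succ m ih =>
    cases k with
    | zero =>
      have h1 := congrArg (a * ·) (ih 0 j (by omega))
      rcases j with _ | j
      · simp only [seqShift_zero, seqShift_succ, seqShift_const_zero, matCoeff, mul_add, mul_sub, mul_smul_comm, smul_sub, smul_add,
          mul_zero, smul_zero, add_zero, sub_zero, pow_zero, one_smul, mul_one, one_mul,
          sub_self, zero_smul]
      · have h2 := congrArg (star c * ·) (ih 0 j (by omega))
        simp only [seqShift_zero, seqShift_succ, seqShift_const_zero, matCoeff, mul_add, mul_sub, mul_smul_comm, smul_sub, smul_add,
          mul_zero, smul_zero, add_zero, sub_zero, pow_zero, one_smul, mul_one, one_mul,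
          sub_self, zero_smul, h.a_c'_mul] at h1 h2 ⊢
        linear_combination (norm := module) (q : ℂ) ^ (j + 1) • h1 - (q : ℂ) ^ 3 • h2
    | succ k =>
      have h1 := congrArg (c * ·) (ih k j (by omega))
      -- In the boundary row `k = m + 1` the recursion `matCoeff_alpha` is not available, but its
      -- factor here is zero.
      have h3 : ((q : ℂ) ^ (2 * k) - (q : ℂ) ^ (2 * m + 2)) •
          (c * ((q : ℂ) ^ k • matCoeff q a c (m + 1) k j)) =
          ((q : ℂ) ^ (2 * k) - (q : ℂ) ^ (2 * m + 2)) •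
          (c * (((q : ℂ) ^ j) • (a * matCoeff q a c m k j) -
            (q : ℂ) • (star c * seqShift (matCoeff q a c m k) j))) := by
        rcases (show k ≤ m ∨ k = m + 1 by omega) with hk | rfl
        · rw [h.matCoeff_alpha m k j hk]
        · rw [mul_add, mul_one, sub_self, zero_smul, zero_smul]
      -- For `k = 0` there is no row above to expand from; the factor `1 - q^(2k)` then vanishes.
      have h4 : (1 - (q : ℂ) ^ (2 * k)) • (c * matCoeff q a c (m + 1) k j) =
          (1 - (q : ℂ) ^ (2 * k)) • (c * (((q : ℂ) ^ j) •
            (c * seqShift (fun i => matCoeff q a c m i j) k) +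
            star a * seqShift (fun i => seqShift (matCoeff q a c m i) j) k)) := by
        cases k with
        | zero => simp
        | succ k => simp only [matCoeff, seqShift_succ]
      rcases j with _ | j
      · simp only [seqShift_zero, seqShift_succ, seqShift_const_zero, matCoeff, mul_add, mul_sub, mul_smul_comm, smul_sub, smul_add,
          mul_zero, smul_zero, add_zero, sub_zero, h.a_c_mul] at h1 h3 h4 ⊢
        linear_combination (norm := module) (q : ℂ) • h1 - ((q : ℂ) * (1 - (q : ℂ) ^ 2)) • h3 -
          ((q : ℂ) * (q : ℂ) ^ k) • h4
      · have h2 := congrArg (star a * ·) (ih k j (by omega))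
        simp only [seqShift_zero, seqShift_succ, seqShift_const_zero, matCoeff, mul_add, mul_sub, mul_smul_comm, smul_sub, smul_add,
          h.a_c_mul, h.a_a'_mul, h.a'_a_mul, h.c'_c_mul, h.c_a'_mul] at h1 h2 h3 h4 ⊢
        linear_combination (norm := module) (q : ℂ) ^ (j + 2) • h1 + (q : ℂ) ^ 3 • h2 -
          ((q : ℂ) ^ (j + 2) * (1 - (q : ℂ) ^ 2)) • h3 - ((q : ℂ) ^ (j + 2) * (q : ℂ) ^ k) • h4

/-- The companion of `matCoeff_column_alpha`, like a q-derivative in `γ`: the column index drops to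
`j - 1`, and `1 - q^(2j)` is the q-number of the exponent of `γ` in `e_j`. -/
theorem matCoeff_column_gamma (h : SUqRel q a c) (m k j : ℕ) (hk : k ≤ m + 1) :
    ((1 - (q : ℂ) ^ (2 * j)) * (q : ℂ) ^ k) • matCoeff q a c (m + 1) k j =
      -((q : ℂ) * ((q : ℂ) ^ (2 * k) - (q : ℂ) ^ (2 * m + 2))) •
          (star c * seqShift (matCoeff q a c m k) j) +
        ((q : ℂ) ^ k * (1 - (q : ℂ) ^ (2 * k))) •
          (star a * seqShift (fun i => seqShift (matCoeff q a c m i) j) k) := by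
  induction m generalizing k j with
  | zero =>
    rcases (show k = 0 ∨ k = 1 by omega) with rfl | rfl <;> rcases j with _ | _ | j <;>
      simp [matCoeff, seqShift, pow_succ, mul_comm]
    module
  | succ m ih =>
    cases k with
    | zero =>
      have h1 := congrArg (a * ·) (ih 0 j (by omega))
      rcases j with _ | j
      · simp only [seqShift_zero, seqShift_succ, seqShift_const_zero, matCoeff, mul_zero, smul_zero, add_zero, sub_zero, pow_zero, one_smul,
          mul_one, one_mul, sub_self, zero_smul]
      · have h2 := congrArg (star c * ·) (ih 0 j (by omega))
        rcases j with _ | j <;>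
        simp only [seqShift_zero, seqShift_succ, seqShift_const_zero, matCoeff, mul_add, mul_sub, mul_smul_comm, smul_sub, smul_add,
          mul_zero, smul_zero, add_zero, sub_zero, pow_zero, one_smul, mul_one, one_mul,
          sub_self, zero_smul, h.a_c'_mul, zero_add] at h1 h2 ⊢
        · linear_combination (norm := module) (q : ℂ) • h1
        · linear_combination (norm := module) (q : ℂ) ^ (j + 2) • h1 - (q : ℂ) ^ 3 • h2
    | succ k =>
      rcases j with _ | j
      ·         simp only [seqShift_zero, seqShift_succ, seqShift_const_zero, matCoeff, mul_zero, smul_zero, add_zero, sub_zero, pow_zero, one_smul,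
          mul_one, one_mul, sub_self, zero_smul, zero_mul]
      have h2 := congrArg (star a * ·) (ih k j (by omega))
      have h4 : (1 - (q : ℂ) ^ (2 * k)) • (star a * matCoeff q a c (m + 1) k j) =
          (1 - (q : ℂ) ^ (2 * k)) • (star a * (((q : ℂ) ^ j) •
            (c * seqShift (fun i => matCoeff q a c m i j) k) +
            star a * seqShift (fun i => seqShift (matCoeff q a c m i) j) k)) := by
        cases k with
        | zero => simp
        | succ k => simp only [matCoeff, seqShift_succ]
      have h1 := congrArg (c * ·) (ih k (j + 1) (by omega))
      simp only [seqShift_zero, seqShift_succ, seqShift_const_zero, matCoeff, mul_add, mul_sub, mul_smul_comm, smul_sub, smul_add,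
        h.c'_a'_mul, h.c'_c_mul, h.c_a'_mul] at h1 h2 h4 ⊢
      linear_combination (norm := module) (q : ℂ) ^ (j + 2) • h1 + (q : ℂ) ^ 3 • h2 -
        ((q : ℂ) ^ (k + 3)) • h4

end SUqRel

/-! ### Orthogonality of the matrix coefficients -/

/-- The `q ^ 2`-factorial `∏_{j ≤ n} (1 - q ^ (2 j))`, without the usual denominator. -/
def qFac (q : ℝ) (n : ℕ) : ℝ := ∏ j ∈ Finset.range n, (1 - q ^ (2 * (j + 1)))

/-- The value of the Haar functional at `γ ^ k * α ^ l * (γ ^ k * α ^ l)⋆`. -/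
def haarWeight (q : ℝ) (k l : ℕ) : ℝ := (1 - q ^ 2) * qFac q k * qFac q l / qFac q (k + l + 1)

theorem one_sub_pow_pos {q : ℝ} (hq0 : 0 < q) (hq1 : q < 1) (n : ℕ) :
    0 < 1 - q ^ (2 * (n + 1)) :=
  sub_pos.2 (pow_lt_one₀ hq0.le hq1 (by omega))

theorem qFac_pos {q : ℝ} (hq0 : 0 < q) (hq1 : q < 1) (n : ℕ) : 0 < qFac q n :=
  Finset.prod_pos fun j _ => one_sub_pow_pos hq0 hq1 j

theorem qFac_succ (q : ℝ) (n : ℕ) : qFac q (n + 1) = qFac q n * (1 - q ^ (2 * (n + 1))) :=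
  Finset.prod_range_succ _ _

theorem haarWeight_zero_zero {q : ℝ} (hq0 : 0 < q) (hq1 : q < 1) : haarWeight q 0 0 = 1 := by
  have := one_sub_pow_pos hq0 hq1 0
  simp only [haarWeight, qFac, Finset.prod_range_zero, Finset.prod_range_one, zero_add, mul_one]
    at this ⊢
  exact div_self this.ne'

/-- The q-numbers in these two weight ratios are exactly those on the left of the column recursions:
this one matches `matCoeff_column_gamma`, the next one `matCoeff_column_alpha`. -/
theorem haarWeight_succ_left {q : ℝ} (hq0 : 0 < q) (hq1 : q < 1) (k l : ℕ) :
    (1 - q ^ (2 * (k + l) + 4)) * haarWeight q (k + 1) l =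
      (1 - q ^ (2 * (k + 1))) * haarWeight q k l := by
  have h1 := (qFac_pos hq0 hq1 (k + l + 1)).ne'
  have h2 := (one_sub_pow_pos hq0 hq1 (k + l + 1)).ne'
  rw [haarWeight, haarWeight, show k + 1 + l + 1 = k + l + 1 + 1 by ring, qFac_succ _ (k + l + 1),
    qFac_succ _ k]
  rw [show 2 * (k + l + 1 + 1) = 2 * (k + l) + 4 by ring] at h2 ⊢
  field_simp

theorem haarWeight_succ_right {q : ℝ} (hq0 : 0 < q) (hq1 : q < 1) (k l : ℕ) :
    (1 - q ^ (2 * (k + l) + 4)) * haarWeight q k (l + 1) =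
      (1 - q ^ (2 * (l + 1))) * haarWeight q k l := by
  have h1 := (qFac_pos hq0 hq1 (k + l + 1)).ne'
  have h2 := (one_sub_pow_pos hq0 hq1 (k + l + 1)).ne'
  rw [haarWeight, haarWeight, show k + (l + 1) + 1 = k + l + 1 + 1 by ring,
    qFac_succ _ (k + l + 1), qFac_succ _ l]
  rw [show 2 * (k + l + 1 + 1) = 2 * (k + l) + 4 by ring] at h2 ⊢
  field_simp

namespace SUqRel

variable {B : Type*} [Ring B] [StarRing B] [Algebra ℂ B] [StarModule ℂ B] {q : ℝ} {a c : B}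

theorem _root_.matCoeff_eq_zero (q : ℝ) (a c : B) (m k j : ℕ) (hj : m < j) :
    matCoeff q a c m k j = 0 := by
  induction m generalizing k j with
  | zero => simp [matCoeff, show j ≠ 0 by omega]
  | succ m ih =>
    obtain ⟨j, rfl⟩ : ∃ i, j = i + 1 := ⟨j - 1, by omega⟩
    cases k <;> simp [matCoeff, seqShift_succ, ih _ _ (show m < j by omega),
      ih _ _ (show m < j + 1 by omega)]

/-- The row recursion sends column `j` of degree `m` to columns `j` and `j + 1` of degree `m + 1`.
Pairing these two contributions and applying the adjoint column recursions to each makes column `j`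
of degree `m` reappear on the right, with its own weight. -/
theorem matCoeff_orthogonal_aux (h : SUqRel q a c) (hq0 : 0 < q) (hq1 : q < 1) (m k j : ℕ)
    (hj : j ≤ m) (hk : k ≤ m + 1) (x y z : B) :
    ((1 - (q : ℂ) ^ (2 * m + 4)) * (q : ℂ) ^ k) •
      ((haarWeight q j (m + 1 - j) : ℂ) • ((q : ℂ) ^ j •
          (y * x * star (matCoeff q a c (m + 1) k j))) +
        (haarWeight q (j + 1) (m + 1 - (j + 1)) : ℂ) •
          (z * x * star (matCoeff q a c (m + 1) k (j + 1)))) =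
      ((q : ℂ) ^ (2 * k) - (q : ℂ) ^ (2 * m + 2)) •
          (y * ((haarWeight q j (m - j) : ℂ) • (x * star (matCoeff q a c m k j))) * star a) +
        ((q : ℂ) ^ k * (1 - (q : ℂ) ^ (2 * k))) •
          (y * ((haarWeight q j (m - j) : ℂ) •
            (x * star (seqShift (fun i => matCoeff q a c m i j) k))) * star c) -
        ((q : ℂ) * ((q : ℂ) ^ (2 * k) - (q : ℂ) ^ (2 * m + 2))) •
          (z * ((haarWeight q j (m - j) : ℂ) • (x * star (matCoeff q a c m k j))) * c) +
        ((q : ℂ) ^ k * (1 - (q : ℂ) ^ (2 * k))) •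
          (z * ((haarWeight q j (m - j) : ℂ) •
            (x * star (seqShift (fun i => matCoeff q a c m i j) k))) * a) := by
  obtain ⟨l, rfl⟩ := Nat.exists_eq_add_of_le hj
  have e1 := congrArg (fun t => y * x * t) (congrArg star (h.matCoeff_column_alpha (j + l) k j hk))
  have e2 := congrArg (fun t => z * x * t)
    (congrArg star (h.matCoeff_column_gamma (j + l) k (j + 1) hk))
  have d1 : (1 - (q : ℂ) ^ (2 * (j + l) + 4)) * (haarWeight q j (l + 1) : ℂ) =
      (1 - (q : ℂ) ^ (2 * (l + 1))) * haarWeight q j l :=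
    mod_cast haarWeight_succ_right hq0 hq1 j l
  have d2 : (1 - (q : ℂ) ^ (2 * (j + l) + 4)) * (haarWeight q (j + 1) l : ℂ) =
      (1 - (q : ℂ) ^ (2 * (j + 1))) * haarWeight q j l :=
    mod_cast haarWeight_succ_left hq0 hq1 j l
  have hs : ∀ n : ℕ, star ((q : ℂ) ^ n) = (q : ℂ) ^ n := fun n => by
    rw [star_pow]; exact congrArg (· ^ n) (Complex.conj_ofReal q)
  have hs1 : star (q : ℂ) = q := Complex.conj_ofReal q
  have hq : (q : ℂ) ^ j ≠ 0 := pow_ne_zero _ (mod_cast hq0.ne')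
  rw [show j + l + 1 - j = l + 1 by omega, show j + l + 1 - (j + 1) = l by omega,
    show j + l - j = l by omega]
  simp only [seqShift_succ, star_smul, star_add, star_neg, star_mul, star_star, star_sub, star_one,
    hs, hs1, mul_add, mul_smul_comm, smul_mul_assoc, mul_assoc, mul_neg, mul_one] at e1 e2 ⊢
  -- The inverse power compensates the factor `q^j` on the right of the `α` column recursion, and
  -- `q^(2j) - q^(2m+2) = q^(2j) (1 - q^(2(l+1)))` on its left.
  have e1' := congrArg (fun t => (((q : ℂ) ^ j)⁻¹ * haarWeight q j l) • t) e1
  have e2' := congrArg (fun t => (haarWeight q j l : ℂ) • t) e2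
  simp only [smul_add, smul_smul] at e1' e2' ⊢
  rw [show (1 - (q : ℂ) ^ (2 * j + 2 * l + 4)) * (q : ℂ) ^ k * ((haarWeight q j (l + 1) : ℂ) * q ^ j)
      = ((q : ℂ) ^ j)⁻¹ * haarWeight q j l * ((q : ℂ) ^ k * ((q : ℂ) ^ (2 * j) -
        (q : ℂ) ^ (2 * j + 2 * l + 2))) from by
      field_simp
      linear_combination (q : ℂ) ^ k * (q : ℂ) ^ (2 * j) * d1,
    show (1 - (q : ℂ) ^ (2 * j + 2 * l + 4)) * (q : ℂ) ^ k * (haarWeight q (j + 1) l : ℂ)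
      = (haarWeight q j l : ℂ) * ((q : ℂ) ^ k * (1 - (q : ℂ) ^ (2 * j + 2))) from by
      linear_combination (q : ℂ) ^ k * d2, e1', e2']
  match_scalars <;> field_simp

/-- The two defining row recursions have the same shape, with `(y, z) = (a, -q c⋆)` in row `0` and
`(c, a⋆)` in the rows `i + 1`. Keeping `y` and `z` free treats both at once and isolates the two
expressions that the relations must evaluate. -/
theorem matCoeff_orthogonal_step (h : SUqRel q a c) (hq0 : 0 < q) (hq1 : q < 1) (m i k : ℕ)
    (hk : k ≤ m + 1)
    (ih : ∀ k ≤ m, ∑ j ∈ Finset.range (m + 1), (haarWeight q j (m - j) : ℂ) •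
      (matCoeff q a c m i j * star (matCoeff q a c m k j)) =
        if i = k then (haarWeight q i (m - i) : ℂ) • (1 : B) else 0) (y z : B) :
    ((1 - (q : ℂ) ^ (2 * m + 4)) * (q : ℂ) ^ k) •
      ∑ j ∈ Finset.range (m + 2), (haarWeight q j (m + 1 - j) : ℂ) •
        (((q : ℂ) ^ j • (y * matCoeff q a c m i j) + z * seqShift (matCoeff q a c m i) j) *
          star (matCoeff q a c (m + 1) k j)) =
      (if i = k then (((q : ℂ) ^ (2 * k) - (q : ℂ) ^ (2 * m + 2)) * haarWeight q i (m - i)) •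
          (y * star a - (q : ℂ) • (z * c)) else 0) +
        (if i + 1 = k then ((q : ℂ) ^ k * (1 - (q : ℂ) ^ (2 * k)) * haarWeight q i (m - i)) •
          (y * star c + z * a) else 0) := by
  set s : B := ∑ j ∈ Finset.range (m + 1), (haarWeight q j (m - j) : ℂ) •
      (matCoeff q a c m i j * star (matCoeff q a c m k j)) with hs
  set s' : B := ∑ j ∈ Finset.range (m + 1), (haarWeight q j (m - j) : ℂ) •
      (matCoeff q a c m i j * star (seqShift (fun i => matCoeff q a c m i j) k)) with hs'
  have key : ((1 - (q : ℂ) ^ (2 * m + 4)) * (q : ℂ) ^ k) •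
      ∑ j ∈ Finset.range (m + 2), (haarWeight q j (m + 1 - j) : ℂ) •
        (((q : ℂ) ^ j • (y * matCoeff q a c m i j) + z * seqShift (matCoeff q a c m i) j) *
          star (matCoeff q a c (m + 1) k j)) =
      ((q : ℂ) ^ (2 * k) - (q : ℂ) ^ (2 * m + 2)) • (y * s * star a) +
        ((q : ℂ) ^ k * (1 - (q : ℂ) ^ (2 * k))) • (y * s' * star c) -
        ((q : ℂ) * ((q : ℂ) ^ (2 * k) - (q : ℂ) ^ (2 * m + 2))) • (z * s * c) +
        ((q : ℂ) ^ k * (1 - (q : ℂ) ^ (2 * k))) • (z * s' * a) := by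
    simp only [add_mul, smul_add, Finset.sum_add_distrib]
    -- The unshifted part loses its last term, since degree `m` has no column `m + 1`; the shifted
    -- part loses its term at `0`. Both then run over `j ≤ m`.
    rw [Finset.sum_range_succ, Finset.sum_range_succ' (fun j => (haarWeight q j (m + 1 - j) : ℂ) •
      (z * seqShift (matCoeff q a c m i) j * star (matCoeff q a c (m + 1) k j)))]
    rw [matCoeff_eq_zero q a c m i (m + 1) (by omega)]
    simp only [seqShift_zero, mul_zero, zero_mul, smul_zero, add_zero, seqShift_succ]
    rw [← smul_add, ← Finset.sum_add_distrib, Finset.smul_sum, hs, hs']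
    simp only [Finset.mul_sum, Finset.sum_mul, Finset.smul_sum, ← Finset.sum_add_distrib,
      ← Finset.sum_sub_distrib]
    refine Finset.sum_congr rfl fun j hj => ?_
    have := h.matCoeff_orthogonal_aux hq0 hq1 m k j (by simpa [Nat.lt_succ_iff] using hj) hk
      (matCoeff q a c m i j) y z
    simpa only [smul_mul_assoc] using this
  have hs1 : ((q : ℂ) ^ (2 * k) - (q : ℂ) ^ (2 * m + 2)) • s =
      if i = k then (((q : ℂ) ^ (2 * k) - (q : ℂ) ^ (2 * m + 2)) * haarWeight q i (m - i)) •
        (1 : B) else 0 := by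
    -- The induction hypothesis stops at row `m`; at `k = m + 1` the coefficient is zero.
    rcases (show k ≤ m ∨ k = m + 1 by omega) with hk | rfl
    · rw [hs, ih k hk]
      split_ifs
      · rw [smul_smul]
      · rw [smul_zero]
    · rw [mul_add, mul_one, sub_self, zero_smul, zero_mul, zero_smul, ite_self]
  have hs2 : ((q : ℂ) ^ k * (1 - (q : ℂ) ^ (2 * k))) • s' =
      if i + 1 = k then ((q : ℂ) ^ k * (1 - (q : ℂ) ^ (2 * k)) * haarWeight q i (m - i)) •
        (1 : B) else 0 := by
    cases k with
    | zero => simp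
    | succ k =>
      simp only [seqShift_succ] at hs'
      rw [hs', ih k (by omega)]
      simp only [add_left_inj]
      split_ifs
      · rw [smul_smul]
      · rw [smul_zero]
  have t1 : ∀ (r : ℂ) (u v w : B), r • (u * v * w) = u * (r • v) * w := fun r u v w => by
    rw [mul_smul_comm, smul_mul_assoc]
  rw [key, mul_smul (q : ℂ) ((q : ℂ) ^ (2 * k) - _), t1 _ y s, t1 _ y s', t1 _ z s c,
    t1 _ z s' a, hs1, hs2]
  split_ifs <;> simp only [mul_smul_comm, smul_mul_assoc, mul_one, mul_zero, zero_mul, smul_zero] <;>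
    module

/-- This is right invariance of the Haar functional in matrix form. After
`matCoeff_orthogonal_step`, the defining relations make one of the two remaining expressions `1` and
the other `0`: the sphere relations give the diagonal, the q-commutation relations kill the rest. -/
theorem matCoeff_orthogonal (h : SUqRel q a c) (hq0 : 0 < q) (hq1 : q < 1) (m i k : ℕ)
    (hi : i ≤ m) (hk : k ≤ m) :
    ∑ j ∈ Finset.range (m + 1), (haarWeight q j (m - j) : ℂ) •
      (matCoeff q a c m i j * star (matCoeff q a c m k j)) =
        if i = k then (haarWeight q i (m - i) : ℂ) • (1 : B) else 0 := by
  induction m generalizing i k with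
  | zero =>
    obtain rfl : i = 0 := by omega
    obtain rfl : k = 0 := by omega
    simp [matCoeff]
  | succ m ih =>
    have hq : (q : ℂ) ≠ 0 := mod_cast hq0.ne'
    have hn : (1 - (q : ℂ) ^ (2 * m + 4)) ≠ 0 := mod_cast (one_sub_pow_pos hq0 hq1 (m + 1)).ne'
    have hn' : (1 - (q : ℂ) ^ (2 * m + 4)) * (q : ℂ) ^ k ≠ 0 := mul_ne_zero hn (pow_ne_zero _ hq)
    refine smul_right_injective _ hn' ?_
    dsimp only
    cases i with
    | zero =>
      have := h.matCoeff_orthogonal_step hq0 hq1 m 0 k hk (fun k hk => ih 0 k (by omega) hk) a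
        (-((q : ℂ) • star c))
      simp only [matCoeff, sub_eq_add_neg, ← neg_mul, ← smul_mul_assoc] at this ⊢
      rw [this]
      have e : (1 - (q : ℂ) ^ (2 * (0 + m) + 4)) * (haarWeight q 0 (m + 1) : ℂ) =
          (1 - (q : ℂ) ^ (2 * (m + 1))) * haarWeight q 0 m := mod_cast haarWeight_succ_right hq0 hq1 0 m
      have e1 : a * star a + -((q : ℂ) • -((q : ℂ) • star c)) * c = 1 := by
        simp only [neg_mul, smul_mul_assoc, smul_neg, neg_neg, ← h.cc', h.a_a', smul_smul]
        module
      have e2 : a * star c + -((q : ℂ) • star c) * a = 0 := by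
        rw [h.ac', neg_mul, smul_mul_assoc, add_neg_cancel]
      rw [e1, e2, smul_zero, ite_self, add_zero]
      split_ifs with hik
      · subst hik
        rw [smul_smul, Nat.sub_zero, Nat.sub_zero]
        congr 1
        rw [zero_add] at e
        linear_combination -e
      · rw [smul_zero]
    | succ i =>
      have := h.matCoeff_orthogonal_step hq0 hq1 m i k hk (fun k hk => ih i k (by omega) hk) c
        (star a)
      simp only [matCoeff]
      rw [this, h.c_a', sub_self, smul_zero, ite_self, zero_add, h.a'_a, add_sub_cancel]
      split_ifs with hik
      · subst hik
        obtain ⟨l, rfl⟩ := Nat.exists_eq_add_of_le (show i ≤ m by omega)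
        have e : (1 - (q : ℂ) ^ (2 * (i + l) + 4)) * (haarWeight q (i + 1) l : ℂ) =
          (1 - (q : ℂ) ^ (2 * (i + 1))) * haarWeight q i l := mod_cast haarWeight_succ_left hq0 hq1 i l
        rw [show i + l - i = l by omega, show i + l + 1 - (i + 1) = l by omega, smul_smul]
        congr 1
        linear_combination - (q : ℂ) ^ (i + 1) * e
      · rw [smul_zero]

end SUqRel

/-! ### Weighted shifts on Hilbert sums -/

section WeightedShift

variable {J E : Type*} [NormedAddCommGroup E] [InnerProductSpace ℂ E]

theorem summable_norm_sq (x : lp (fun _ : J => E) 2) : Summable fun j => ‖x j‖ ^ 2 := by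
  have := (lp.memℓp x).summable (by norm_num)
  simpa using this

theorem lp_two_norm_sq (x : lp (fun _ : J => E) 2) : ‖x‖ ^ 2 = ∑' j, ‖x j‖ ^ 2 := by
  have := lp.norm_rpow_eq_tsum (p := 2) (by norm_num) x
  simpa using this

theorem norm_sq_weighted_le {T : E →L[ℂ] E} {w : J → ℝ} {σ : J → J} (hw : ∀ j, |w j| ≤ 1)
    (x : lp (fun _ : J => E) 2) (j : J) :
    ‖(w j : ℂ) • T (x (σ j))‖ ^ 2 ≤ ‖T‖ ^ 2 * ‖x (σ j)‖ ^ 2 := by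
  rw [← mul_pow]
  refine pow_le_pow_left₀ (norm_nonneg _) ?_ 2
  rw [norm_smul, Complex.norm_real, Real.norm_eq_abs]
  calc |w j| * ‖T (x (σ j))‖ ≤ 1 * ‖T (x (σ j))‖ := by gcongr; exact hw j
    _ ≤ ‖T‖ * ‖x (σ j)‖ := by rw [one_mul]; exact T.le_opNorm _

theorem memℓp_weighted {T : E →L[ℂ] E} {w : J → ℝ} {σ : J → J} (hw : ∀ j, |w j| ≤ 1)
    (hσ : Function.Injective σ) (x : lp (fun _ : J => E) 2) :
    Memℓp (fun j => (w j : ℂ) • T (x (σ j))) 2 := by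
  refine memℓp_gen ?_
  simp only [ENNReal.toReal_ofNat, Real.rpow_ofNat]
  exact Summable.of_nonneg_of_le (fun _ => by positivity) (norm_sq_weighted_le hw x)
    (((summable_norm_sq x).comp_injective hσ).mul_left _)

/-- The operator `x ↦ (w j • T (x (σ j)))_j` on a Hilbert sum of copies of `E`. -/
def weightedShift (T : E →L[ℂ] E) (w : J → ℝ) (σ : J → J) (hw : ∀ j, |w j| ≤ 1)
    (hσ : Function.Injective σ) : lp (fun _ : J => E) 2 →L[ℂ] lp (fun _ : J => E) 2 :=
  LinearMap.mkContinuous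
    { toFun := fun x => ⟨fun j => (w j : ℂ) • T (x (σ j)), memℓp_weighted hw hσ x⟩
      map_add' := fun x y => lp.ext <| funext fun j => by
        change (w j : ℂ) • T ((x + y) (σ j)) = (w j : ℂ) • T (x (σ j)) + (w j : ℂ) • T (y (σ j))
        simp
      map_smul' := fun r x => lp.ext <| funext fun j => by
        change (w j : ℂ) • T ((r • x) (σ j)) = r • (w j : ℂ) • T (x (σ j))
        simp [smul_comm r] }
    ‖T‖ fun x => by
      refine le_of_sq_le_sq ?_ (by positivity)
      rw [mul_pow, lp_two_norm_sq, lp_two_norm_sq, ← tsum_mul_left]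
      have hs := (summable_norm_sq x).mul_left (‖T‖ ^ 2)
      calc _ ≤ ∑' j, ‖T‖ ^ 2 * ‖x (σ j)‖ ^ 2 :=
            Summable.tsum_le_tsum (norm_sq_weighted_le hw x)
              (summable_norm_sq (⟨_, memℓp_weighted hw hσ x⟩ : lp (fun _ : J => E) 2))
              (hs.comp_injective hσ)
        _ ≤ _ := tsum_comp_le_tsum_of_inj hs (fun _ => by positivity) hσ

variable {T : E →L[ℂ] E} {w : J → ℝ} {σ : J → J} {hw : ∀ j, |w j| ≤ 1}
  {hσ : Function.Injective σ}

theorem weightedShift_apply (x : lp (fun _ : J => E) 2) (j : J) :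
    weightedShift T w σ hw hσ x j = (w j : ℂ) • T (x (σ j)) := rfl

variable [CompleteSpace E]

/-- Injectivity of `σ` makes the operator carry a vector supported at `σ j` to one supported at `j`;
the adjoint is read off by pairing with such vectors. -/
theorem star_weightedShift_apply (y : lp (fun _ : J => E) 2) (j : J) :
    (star (weightedShift T w σ hw hσ) y) (σ j) = (w j : ℂ) • (star T) (y j) := by
  classical
  refine ext_inner_left ℂ fun v => ?_
  rw [← lp.inner_single_left (𝕜 := ℂ) (G := fun _ : J => E) (σ j) v,
    ContinuousLinearMap.star_eq_adjoint, ContinuousLinearMap.adjoint_inner_right]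
  have : weightedShift T w σ hw hσ (lp.single 2 (σ j) v) = lp.single 2 j ((w j : ℂ) • T v) := by
    refine lp.ext (funext fun i => ?_)
    rw [weightedShift_apply]
    by_cases hij : i = j
    · subst hij
      rw [lp.single_apply_self, lp.single_apply_self]
    · rw [lp.single_apply_ne _ _ _ hij, lp.single_apply_ne _ _ _ (hσ.ne hij), map_zero, smul_zero]
  rw [this, lp.inner_single_left, inner_smul_left, inner_smul_right, Complex.conj_ofReal,
    ContinuousLinearMap.star_eq_adjoint, ContinuousLinearMap.adjoint_inner_right]

theorem star_weightedShift_apply_of_notMem (y : lp (fun _ : J => E) 2) (k : J)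
    (hk : ∀ j, w j ≠ 0 → σ j ≠ k) : (star (weightedShift T w σ hw hσ) y) k = 0 := by
  classical
  refine ext_inner_left ℂ fun v => ?_
  rw [← lp.inner_single_left (𝕜 := ℂ) (G := fun _ : J => E) k v,
    ContinuousLinearMap.star_eq_adjoint, ContinuousLinearMap.adjoint_inner_right]
  have : weightedShift T w σ hw hσ (lp.single 2 k v) = 0 := by
    refine lp.ext (funext fun i => ?_)
    rw [weightedShift_apply]
    by_cases hi : w i = 0
    · simp [hi]
    · rw [lp.single_apply_ne _ _ _ (hk i hi), map_zero, smul_zero]; rfl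
  rw [this, inner_zero_left, inner_zero_right]

/-- The amplification `T ↦ T ⊗ 1` to a Hilbert sum. -/
def amplify (J E : Type*) [NormedAddCommGroup E] [InnerProductSpace ℂ E] [CompleteSpace E] :
    (E →L[ℂ] E) →⋆ₐ[ℂ] (lp (fun _ : J => E) 2 →L[ℂ] lp (fun _ : J => E) 2) where
  toFun T := weightedShift T 1 id (fun _ => by simp) Function.injective_id
  map_one' := by
    ext x j; simp [weightedShift_apply]
  map_mul' S T := by
    ext x j; simp [weightedShift_apply]
  map_zero' := by
    ext x j; simp [weightedShift_apply]
  map_add' S T := by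
    ext x j; simp [weightedShift_apply]
  commutes' r := by
    ext x j; simp [weightedShift_apply, Algebra.algebraMap_eq_smul_one]
  map_star' T := by
    ext x j
    have := star_weightedShift_apply (T := T) (w := 1) (σ := id) (hw := fun _ : J => by simp)
      (hσ := Function.injective_id) x j
    rw [id] at this
    rw [this, weightedShift_apply, id]

theorem amplify_apply (T : E →L[ℂ] E) (x : lp (fun _ : J => E) 2) (j : J) :
    amplify J E T x j = T (x j) := by
  change ((1 : ℝ) : ℂ) • T (x j) = T (x j)
  simp

end WeightedShift

/-! ### Transport of the relations along *-homomorphisms, and compressions to a summand. -/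

theorem SUqRel.map {B C : Type*} [Ring B] [StarRing B] [Algebra ℂ B] [Ring C] [StarRing C]
    [Algebra ℂ C] {q : ℝ} {a c : B} (h : SUqRel q a c) (φ : B →⋆ₐ[ℂ] C) :
    SUqRel q (φ a) (φ c) := by
  constructor
  · rw [← map_mul, h.ac, map_smul, map_mul]
  · rw [← map_star, ← map_mul, h.ac', map_smul, map_mul]
  · rw [← map_star, ← map_mul, h.cc', map_mul]
  · rw [← map_star, ← map_star, ← map_mul, ← map_mul, ← map_add, h.sphere, map_one]
  · rw [← map_star, ← map_star, ← map_mul, ← map_mul, ← map_smul, ← map_add, h.sphere', map_one]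

theorem SUqComm.map {B C : Type*} [Ring B] [StarRing B] [Algebra ℂ B] [Ring C] [StarRing C]
    [Algebra ℂ C] {a₁ c₁ a₂ c₂ : B} (h : SUqComm a₁ c₁ a₂ c₂) (φ : B →⋆ₐ[ℂ] C) :
    SUqComm (φ a₁) (φ c₁) (φ a₂) (φ c₂) := by
  constructor <;> try simp only [← map_star]
  exacts [h.aa.map φ, h.aa'.map φ, h.ac.map φ, h.ac'.map φ, h.ca.map φ, h.ca'.map φ, h.cc.map φ,
    h.cc'.map φ]

section

/-- The map `T ↦ W T V` on bounded operators. -/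
def sandwich {E K : Type*} [NormedAddCommGroup E] [NormedSpace ℂ E] [NormedAddCommGroup K]
    [NormedSpace ℂ K] (W : K →L[ℂ] E) (V : E →L[ℂ] K) : (K →L[ℂ] K) →L[ℂ] (E →L[ℂ] E) :=
  (ContinuousLinearMap.compL ℂ E K E W) ∘L ((ContinuousLinearMap.compL ℂ E K K).flip V)

theorem norm_sandwich_apply_le {E K : Type*} [NormedAddCommGroup E] [NormedSpace ℂ E]
    [NormedAddCommGroup K] [NormedSpace ℂ K] {W : K →L[ℂ] E} {V : E →L[ℂ] K} (hW : ‖W‖ ≤ 1)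
    (hV : ‖V‖ ≤ 1) (T : K →L[ℂ] K) : ‖sandwich W V T‖ ≤ ‖T‖ := by
  calc ‖W ∘L (T ∘L V)‖ ≤ ‖W‖ * (‖T‖ * ‖V‖) :=
        (W.opNorm_comp_le _).trans (by gcongr; exact T.opNorm_comp_le V)
    _ ≤ 1 * (‖T‖ * 1) := by gcongr
    _ = ‖T‖ := by ring

variable {J E : Type*} [DecidableEq J] [NormedAddCommGroup E] [InnerProductSpace ℂ E]

/-- The inclusion of a summand into a Hilbert sum. -/
def inclL (j : J) : E →L[ℂ] lp (fun _ : J => E) 2 :=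
  lp.singleContinuousLinearMap ℂ (fun _ : J => E) 2 j

/-- The projection of a Hilbert sum to a summand. -/
def evalL (j : J) : lp (fun _ : J => E) 2 →L[ℂ] E :=
  lp.evalCLM ℂ (fun _ : J => E) 2 j

theorem norm_inclL_le (j : J) : ‖(inclL j : E →L[ℂ] lp (fun _ : J => E) 2)‖ ≤ 1 :=
  ContinuousLinearMap.opNorm_le_bound _ zero_le_one fun x => by
    rw [one_mul]; exact (lp.norm_single (E := fun _ : J => E) (p := 2) (by norm_num) j x).le

theorem norm_evalL_le (j : J) : ‖(evalL j : lp (fun _ : J => E) 2 →L[ℂ] E)‖ ≤ 1 :=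
  ContinuousLinearMap.opNorm_le_bound _ zero_le_one fun x => by
    rw [one_mul]; exact lp.norm_apply_le_norm (by norm_num) _ j

/-- The compression of an operator on a Hilbert sum to the summand with index `j`. -/
def compress (j : J) : (lp (fun _ : J => E) 2 →L[ℂ] lp (fun _ : J => E) 2) →L[ℂ] (E →L[ℂ] E) :=
  sandwich (evalL j) (inclL j)

theorem compress_apply (j : J)
    (T : lp (fun _ : J => E) 2 →L[ℂ] lp (fun _ : J => E) 2) (x : E) :
    compress j T x = T (lp.single 2 j x) j := rfl

theorem norm_compress_apply_le (j : J) (T : lp (fun _ : J => E) 2 →L[ℂ] lp (fun _ : J => E) 2) :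
    ‖compress j T‖ ≤ ‖T‖ := norm_sandwich_apply_le (norm_evalL_le j) (norm_inclL_le j) T

theorem compress_amplify_mul [CompleteSpace E] (j : J) (A : E →L[ℂ] E)
    (T : lp (fun _ : J => E) 2 →L[ℂ] lp (fun _ : J => E) 2) :
    compress j (amplify J E A * T) = A * compress j T := by
  ext x
  simp only [compress_apply, mul_apply_eq_comp, amplify_apply]

end

/-! ### The regular representation -/

/-- The Hilbert sum of copies of `ℓ²(ℕ)` indexed by `ℕ × ℤ`. -/
abbrev RegSpace : Type := lp (fun _ : ℕ × ℤ => lp (fun _ : ℕ => ℂ) 2) 2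

theorem sqrt_weight_le {q : ℝ} (n : ℕ) : |√(1 - q ^ (2 * (n + 1)))| ≤ 1 := by
  rw [abs_of_nonneg (Real.sqrt_nonneg _)]
  refine Real.sqrt_le_one.2 (sub_le_self _ ?_)
  rw [pow_mul]; positivity

theorem pow_weight_le {q : ℝ} (hq0 : 0 < q) (hq1 : q < 1) (n : ℕ) : |q ^ n| ≤ 1 := by
  rw [abs_of_pos (pow_pos hq0 n)]
  exact pow_le_one₀ hq0.le hq1.le

/-- The operator `α` of the regular representation. -/
def regAlpha (q : ℝ) : RegSpace →L[ℂ] RegSpace :=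
  weightedShift 1 (fun p => √(1 - q ^ (2 * (p.1 + 1)))) (fun p => (p.1 + 1, p.2))
    (fun p => sqrt_weight_le p.1) fun p p' h => by
      simp only [Prod.mk.injEq, add_left_inj] at h
      exact Prod.ext h.1 h.2

/-- The operator `γ` of the regular representation. -/
def regGamma {q : ℝ} (hq0 : 0 < q) (hq1 : q < 1) : RegSpace →L[ℂ] RegSpace :=
  weightedShift 1 (fun p => q ^ p.1) (fun p => (p.1, p.2 + 1))
    (fun p => pow_weight_le hq0 hq1 p.1) fun p p' h => by
      simp only [Prod.mk.injEq, add_left_inj] at h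
      exact Prod.ext h.1 h.2

section

variable {q : ℝ} (hq0 : 0 < q) (hq1 : q < 1)

theorem regAlpha_apply (x : RegSpace) (n : ℕ) (z : ℤ) :
    regAlpha q x (n, z) = (√(1 - q ^ (2 * (n + 1))) : ℂ) • x (n + 1, z) := rfl

theorem regGamma_apply (x : RegSpace) (n : ℕ) (z : ℤ) :
    regGamma hq0 hq1 x (n, z) = ((q ^ n : ℝ) : ℂ) • x (n, z + 1) := rfl

theorem star_regAlpha_apply (x : RegSpace) (n : ℕ) (z : ℤ) :
    star (regAlpha q) x (n + 1, z) = (√(1 - q ^ (2 * (n + 1))) : ℂ) • x (n, z) :=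
  (star_weightedShift_apply x (n, z)).trans (by rw [star_one]; rfl)

theorem star_regAlpha_apply_zero (x : RegSpace) (z : ℤ) :
    star (regAlpha q) x (0, z) = 0 :=
  star_weightedShift_apply_of_notMem x (0, z) fun p _ => by simp

theorem star_regGamma_apply (x : RegSpace) (n : ℕ) (z : ℤ) :
    star (regGamma hq0 hq1) x (n, z) = ((q ^ n : ℝ) : ℂ) • x (n, z - 1) := by
  have := star_weightedShift_apply (T := (1 : BOp)) (w := fun p : ℕ × ℤ => q ^ p.1)
    (σ := fun p => (p.1, p.2 + 1)) (hw := fun p => pow_weight_le hq0 hq1 p.1)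
    (hσ := fun p p' h => by
      simp only [Prod.mk.injEq, add_left_inj] at h
      exact Prod.ext h.1 h.2) x (n, z - 1)
  simp only [sub_add_cancel] at this
  exact this.trans (by rw [star_one]; rfl)

/-- The amplification of operators on `ℓ²(ℕ)` to the space of the regular representation. -/
abbrev regAmplify : BOp →⋆ₐ[ℂ] (RegSpace →L[ℂ] RegSpace) := amplify (ℕ × ℤ) (lp (fun _ : ℕ => ℂ) 2)

theorem reg_rel : SUqRel q (regAlpha q) (regGamma hq0 hq1) := by
  have hs : ∀ n : ℕ, (√(1 - q ^ (2 * (n + 1))) : ℂ) * (√(1 - q ^ (2 * (n + 1))) : ℂ) =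
      1 - (q : ℂ) ^ (2 * (n + 1)) := fun n => by
    rw [← Complex.ofReal_mul, Real.mul_self_sqrt (one_sub_pow_pos hq0 hq1 n).le]
    push_cast; rfl
  constructor <;> ext x : 1 <;> refine lp.ext (funext fun ⟨n, z⟩ => ?_) <;>
    simp only [mul_apply_eq_comp, smul_apply, lp.coeFn_smul,
      Pi.smul_apply, add_apply, lp.coeFn_add, Pi.add_apply,
      one_apply_eq_self]
  · simp only [regAlpha_apply, regGamma_apply, smul_smul]
    congr 1; push_cast; ring
  · simp only [regAlpha_apply, star_regGamma_apply, smul_smul]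
    congr 1; push_cast; ring
  · simp only [regGamma_apply, star_regGamma_apply, smul_smul, add_sub_cancel_right,
      sub_add_cancel]
  -- At `n = 0` the term `α⋆α` vanishes and `γ⋆γ` alone gives the identity, its weight being `q^0`.
  · rcases n with _ | n
    · simp [star_regAlpha_apply_zero, regGamma_apply, star_regGamma_apply]
    · simp only [star_regAlpha_apply, regAlpha_apply, regGamma_apply, star_regGamma_apply, smul_smul,
        sub_add_cancel, hs, ← add_smul]
      convert one_smul ℂ _ using 2
      push_cast; ring
  · simp only [star_regAlpha_apply, regAlpha_apply, regGamma_apply, star_regGamma_apply, smul_smul,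
      add_sub_cancel_right, hs, ← add_smul]
    convert one_smul ℂ _ using 2
    push_cast; ring

theorem amplify_comm (T S : BOp) :
    SUqComm (regAmplify T) (regAmplify S) (regAlpha q) (regGamma hq0 hq1) := by
  have ha : ∀ T : BOp, Commute (regAmplify T) (regAlpha q) := fun T => by
    ext x : 1
    refine lp.ext (funext fun ⟨n, z⟩ => ?_)
    simp only [mul_apply_eq_comp, regAlpha_apply, amplify_apply, map_smul]
  have hc : ∀ T : BOp, Commute (regAmplify T) (regGamma hq0 hq1) := fun T => by
    ext x : 1
    refine lp.ext (funext fun ⟨n, z⟩ => ?_)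
    simp only [mul_apply_eq_comp, regGamma_apply, amplify_apply, map_smul]
  have hst : ∀ (T : BOp) (X : RegSpace →L[ℂ] RegSpace),
      (∀ T : BOp, Commute (regAmplify T) X) → Commute (regAmplify T) (star X) :=
    fun T X h => by simpa [← map_star] using (h (star T)).star_star
  exact ⟨ha T, hst T _ ha, hc T, hst T _ hc, ha S, hst S _ ha, hc S, hst S _ hc⟩

/-- The matrix entries of `γ ^ k * α ^ i` in the regular representation. -/
def regWeight (q : ℝ) (k i n : ℕ) : ℝ :=
  q ^ (n * k) * ∏ r ∈ Finset.range i, √(1 - q ^ (2 * (n + r + 1)))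

theorem reg_monomial_apply (k i : ℕ) (x : RegSpace) (n : ℕ) (z : ℤ) :
    (regGamma hq0 hq1 ^ k * regAlpha q ^ i) x (n, z) = (regWeight q k i n : ℂ) • x (n + i, z + k) := by
  have hA : ∀ (n : ℕ) (z : ℤ), (regAlpha q ^ i) x (n, z) =
      ((∏ r ∈ Finset.range i, √(1 - q ^ (2 * (n + r + 1))) : ℝ) : ℂ) • x (n + i, z) := by
    induction i with
    | zero => intro n z; simp
    | succ i ih =>
      intro n z
      rw [pow_succ', mul_apply_eq_comp, regAlpha_apply, ih, smul_smul,
        Finset.prod_range_succ', mul_comm]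
      simp only [← Complex.ofReal_mul]
      rw [show n + 1 + i = n + (i + 1) by ring]
      congr 3
      exact Finset.prod_congr rfl fun r _ => by congr 3; ring
  induction k generalizing z with
  | zero =>
    rw [pow_zero, one_mul, hA, regWeight, mul_zero, pow_zero, one_mul, Nat.cast_zero, add_zero]
  | succ k ih =>
    rw [pow_succ', mul_assoc, mul_apply_eq_comp, regGamma_apply, ih, smul_smul]
    simp only [regWeight, ← Complex.ofReal_mul]
    rw [show z + 1 + (k : ℤ) = z + ((k + 1 : ℕ) : ℤ) by push_cast; ring]
    congr 2
    ring

theorem star_reg_monomial_single (k i n : ℕ) (z : ℤ) (v : lp (fun _ : ℕ => ℂ) 2) :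
    star (regGamma hq0 hq1 ^ k * regAlpha q ^ i) (lp.single 2 (n, z) v) =
      lp.single 2 (n + i, z + (k : ℤ)) ((regWeight q k i n : ℂ) • v) := by
  refine ext_inner_left ℂ fun u => ?_
  rw [ContinuousLinearMap.star_eq_adjoint, ContinuousLinearMap.adjoint_inner_right,
    lp.inner_single_right, lp.inner_single_right, reg_monomial_apply, inner_smul_left,
    inner_smul_right, Complex.conj_ofReal]

/-- The adjoint of `γ^l α^j` moves the site `(n, 0)` to `(n + j, l)`, and `γ^k α^i` reads its value
at `(n, 0)` from `(n + i, k)`. A diagonal entry therefore survives only when the two sites agree. -/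
theorem compress_reg_monomial (k i l j n : ℕ) :
    compress (n, (0 : ℤ)) (regGamma hq0 hq1 ^ k * regAlpha q ^ i *
      star (regGamma hq0 hq1 ^ l * regAlpha q ^ j)) =
      if k = l ∧ i = j then ((regWeight q k i n : ℂ) ^ 2) • (1 : BOp) else 0 := by
  ext1 v
  rw [compress_apply, mul_apply_eq_comp, star_reg_monomial_single, reg_monomial_apply]
  split_ifs with h
  · obtain ⟨rfl, rfl⟩ := h
    rw [lp.single_apply_self, smul_smul, ← sq]; rfl
  · rw [lp.single_apply_ne, smul_zero]; rfl
    simp only [zero_add, ne_eq, Prod.mk.injEq, add_right_inj, Nat.cast_inj]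
    tauto

theorem regWeight_sq_succ {q : ℝ} (hq0 : 0 < q) (hq1 : q < 1) (k i n : ℕ) : regWeight q k (i + 1) n ^ 2 =
    regWeight q k i n ^ 2 - q ^ (2 * i + 2) * regWeight q (k + 1) i n ^ 2 := by
  rw [regWeight, Finset.prod_range_succ, mul_pow, mul_pow,
    Real.sq_sqrt (one_sub_pow_pos hq0 hq1 (n + i)).le, regWeight, regWeight, mul_pow, mul_pow]
  ring

/-- A q-beta sum. For `i = 0` it is a geometric series; splitting the last factor `1 - q^(2(n+i+1))`
reduces `i + 1` to `i` with exponents `k` and `k + 1`, and the weights obey the same recursion. -/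
theorem hasSum_regWeight {q : ℝ} (hq0 : 0 < q) (hq1 : q < 1) (k i : ℕ) :
    HasSum (fun n : ℕ => (1 - q ^ 2) * q ^ (2 * n) * regWeight q k i n ^ 2) (haarWeight q k i) := by
  induction i generalizing k with
  | zero =>
    have h0 : 0 < q ^ (2 * (k + 1)) := pow_pos hq0 _
    have h1 : q ^ (2 * (k + 1)) < 1 := pow_lt_one₀ hq0.le hq1 (by omega)
    have hf : (fun n : ℕ => (1 - q ^ 2) * q ^ (2 * n) * regWeight q k 0 n ^ 2) =
        fun n => (1 - q ^ 2) * (q ^ (2 * (k + 1))) ^ n := by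
      ext n
      simp only [regWeight, Finset.prod_range_zero, mul_one]
      ring
    have hv : haarWeight q k 0 = (1 - q ^ 2) * (1 - q ^ (2 * (k + 1)))⁻¹ := by
      have := (qFac_pos hq0 hq1 k).ne'
      have h2 := (one_sub_pow_pos hq0 hq1 k).ne'
      rw [haarWeight, add_zero, qFac_succ, show qFac q 0 = 1 from Finset.prod_range_zero _]
      field_simp
    rw [hf, hv]
    exact (hasSum_geometric_of_lt_one h0.le h1).mul_left (1 - q ^ 2)
  | succ i ih =>
    have hf : (fun n : ℕ => (1 - q ^ 2) * q ^ (2 * n) * regWeight q k (i + 1) n ^ 2) =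
        fun n => (1 - q ^ 2) * q ^ (2 * n) * regWeight q k i n ^ 2 -
          q ^ (2 * i + 2) * ((1 - q ^ 2) * q ^ (2 * n) * regWeight q (k + 1) i n ^ 2) := by
      ext n
      rw [regWeight_sq_succ hq0 hq1]; ring
    have hv : haarWeight q k (i + 1) =
        haarWeight q k i - q ^ (2 * i + 2) * haarWeight q (k + 1) i := by
      have e := haarWeight_succ_right hq0 hq1 k i
      have e' := haarWeight_succ_left hq0 hq1 k i
      have hn := (one_sub_pow_pos hq0 hq1 (k + i + 1)).ne'
      rw [show 2 * (k + i + 1 + 1) = 2 * (k + i) + 4 by ring] at hn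
      apply mul_left_cancel₀ hn
      linear_combination e + q ^ (2 * i + 2) * e'
    rw [hf, hv]
    exact (ih k).sub ((ih (k + 1)).mul_left (q ^ (2 * i + 2)))

end

/-- An enumeration of the canonical orthonormal basis of `RegSpace`. -/
def regIndex : ℕ ≃ (ℕ × ℤ) × ℕ := (nonempty_equiv_of_countable (α := ℕ) (β := (ℕ × ℤ) × ℕ)).some

theorem orthonormal_regVector : Orthonormal ℂ (fun m : ℕ =>
    (lp.single 2 (regIndex m).1 (lp.single 2 (regIndex m).2 (1 : ℂ)) : RegSpace)) := by
  rw [orthonormal_iff_ite]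
  intro i j
  rw [lp.inner_single_left]
  by_cases hij : i = j
  · subst hij
    rw [lp.single_apply_self, lp.inner_single_left, lp.single_apply_self, if_pos rfl]
    simp
  · rw [if_neg hij]
    by_cases h1 : (regIndex i).1 = (regIndex j).1
    · have h2 : (regIndex i).2 ≠ (regIndex j).2 := fun h2 =>
        hij (regIndex.injective (Prod.ext h1 h2))
      rw [h1, lp.single_apply_self, lp.inner_single_left, lp.single_apply_ne _ _ _ h2,
        inner_zero_right]
    · rw [lp.single_apply_ne _ _ _ h1, inner_zero_right]

/-- The canonical orthonormal basis of `RegSpace`. -/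
def regBasis : HilbertBasis ℕ ℂ RegSpace :=
  HilbertBasis.mkOfOrthogonalEqBot orthonormal_regVector <| by
    rw [Submodule.eq_bot_iff]
    intro x hx
    rw [Submodule.mem_orthogonal] at hx
    refine lp.ext (funext fun p => lp.ext (funext fun n => ?_))
    have := hx _ (Submodule.subset_span ⟨regIndex.symm (p, n), rfl⟩)
    dsimp only at this
    rw [Equiv.apply_symm_apply, lp.inner_single_left, lp.inner_single_left] at this
    simpa using this

/-- The transport of operators along a unitary `RegSpace ≃ ℓ²(ℕ)`. -/
def regConj : (RegSpace →L[ℂ] RegSpace) ≃⋆ₐ[ℂ] BOp := regBasis.repr.conjStarAlgEquiv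

theorem norm_regConj_symm_le (T : BOp) : ‖regConj.symm T‖ ≤ ‖T‖ :=
  NonUnitalStarAlgHom.norm_apply_le (regConj.symm : BOp →⋆ₐ[ℂ] (RegSpace →L[ℂ] RegSpace)) T

/-! ### Weighted series of contractions. -/

section

variable {X Y : Type*} [NormedAddCommGroup X] [NormedSpace ℂ X] [NormedAddCommGroup Y]
  [NormedSpace ℂ Y] [CompleteSpace Y]

theorem norm_weighted_apply_le {w : ℕ → ℝ} (hw0 : ∀ n, 0 ≤ w n) {f : ℕ → X →L[ℂ] Y}
    (hf : ∀ n x, ‖f n x‖ ≤ ‖x‖) (x : X) (n : ℕ) : ‖(w n : ℂ) • f n x‖ ≤ w n * ‖x‖ := by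
  rw [norm_smul, Complex.norm_real, Real.norm_of_nonneg (hw0 n)]
  exact mul_le_mul_of_nonneg_left (hf n x) (hw0 n)

theorem summable_weighted {w : ℕ → ℝ} (hw : Summable w) (hw0 : ∀ n, 0 ≤ w n) {f : ℕ → X →L[ℂ] Y}
    (hf : ∀ n x, ‖f n x‖ ≤ ‖x‖) (x : X) : Summable fun n => (w n : ℂ) • f n x :=
  Summable.of_norm_bounded (hw.mul_right ‖x‖) (norm_weighted_apply_le hw0 hf x)

/-- The sum of a series of contractions with summable weights. -/
def weightedSeries {w : ℕ → ℝ} (hw : Summable w) (hw0 : ∀ n, 0 ≤ w n) {f : ℕ → X →L[ℂ] Y}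
    (hf : ∀ n x, ‖f n x‖ ≤ ‖x‖) : X →L[ℂ] Y :=
  LinearMap.mkContinuous
    { toFun := fun x => ∑' n, (w n : ℂ) • f n x
      map_add' := fun x y => by
        simp only [map_add, smul_add]
        exact (summable_weighted hw hw0 hf x).tsum_add (summable_weighted hw hw0 hf y)
      map_smul' := fun r x => by
        simp only [map_smul, smul_comm _ r]
        exact (summable_weighted hw hw0 hf x).tsum_const_smul r }
    (∑' n, w n) fun x => by
      rw [← tsum_mul_right]
      exact tsum_of_norm_bounded (hw.mul_right ‖x‖).hasSum (norm_weighted_apply_le hw0 hf x)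

theorem hasSum_weightedSeries {w : ℕ → ℝ} (hw : Summable w) (hw0 : ∀ n, 0 ≤ w n)
    {f : ℕ → X →L[ℂ] Y} (hf : ∀ n x, ‖f n x‖ ≤ ‖x‖) (x : X) :
    HasSum (fun n => (w n : ℂ) • f n x) (weightedSeries hw hw0 hf x) :=
  (summable_weighted hw hw0 hf x).hasSum

end

section

variable {q : ℝ} (hq0 : 0 < q) (hq1 : q < 1)

/-- The regular representation, on `ℓ²(ℕ)`. -/
def regPair : SUqPair q where
  a := regConj (regAlpha q)
  c := regConj (regGamma hq0 hq1)
  rel := (reg_rel hq0 hq1).map (regConj : (RegSpace →L[ℂ] RegSpace) →⋆ₐ[ℂ] BOp)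

/-- The pair consisting of a multiple of a given representation and of the regular one. -/
def regCommPair (i : SUqPair q) : SUqCommPair q where
  fst :=
    { a := regConj (regAmplify i.a)
      c := regConj (regAmplify i.c)
      rel := (i.rel.map regAmplify).map (regConj : (RegSpace →L[ℂ] RegSpace) →⋆ₐ[ℂ] BOp) }
  snd := regPair hq0 hq1
  comm := (amplify_comm hq0 hq1 i.a i.c).map (regConj : (RegSpace →L[ℂ] RegSpace) →⋆ₐ[ℂ] BOp)

theorem summable_geometric_sq {q : ℝ} (hq0 : 0 < q) (hq1 : q < 1) :
    Summable fun n : ℕ => (1 - q ^ 2) * q ^ (2 * n) := by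
  simp_rw [pow_mul]
  exact (summable_geometric_of_lt_one (sq_nonneg q) (by nlinarith)).mul_left _

theorem sq_weight_nonneg {q : ℝ} (hq0 : 0 < q) (hq1 : q < 1) (n : ℕ) :
    0 ≤ (1 - q ^ 2) * q ^ (2 * n) :=
  mul_nonneg (one_sub_pow_pos hq0 hq1 0).le (by positivity)

/-- The weighted sum `(1 - q²) ∑ q ^ (2 n) T_{(n,0),(n,0)}` of the diagonal entries of `T`. -/
def regTrace : (RegSpace →L[ℂ] RegSpace) →L[ℂ] BOp :=
  weightedSeries (summable_geometric_sq hq0 hq1) (sq_weight_nonneg hq0 hq1)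
    (f := fun n : ℕ => compress (n, (0 : ℤ))) fun _ => norm_compress_apply_le _

theorem hasSum_regTrace (T : RegSpace →L[ℂ] RegSpace) :
    HasSum (fun n : ℕ => (((1 - q ^ 2) * q ^ (2 * n) : ℝ) : ℂ) • compress (n, (0 : ℤ)) T)
      (regTrace hq0 hq1 T) :=
  hasSum_weightedSeries _ _ _ T

/-- This module property is the reason for copies of `ℓ²(ℕ)` at each site: the first tensor leg acts
within the copies and passes through the weighted trace, which thus becomes a slice map. -/
theorem regTrace_amplify_mul (A : BOp) (T : RegSpace →L[ℂ] RegSpace) :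
    regTrace hq0 hq1 (regAmplify A * T) = A * regTrace hq0 hq1 T := by
  refine (hasSum_regTrace hq0 hq1 _).unique ?_
  simp only [compress_amplify_mul, ← mul_smul_comm]
  exact (hasSum_regTrace hq0 hq1 T).mul_left A

theorem regTrace_monomial (k i l j : ℕ) :
    regTrace hq0 hq1 (regGamma hq0 hq1 ^ k * regAlpha q ^ i *
      star (regGamma hq0 hq1 ^ l * regAlpha q ^ j)) =
      if k = l ∧ i = j then (haarWeight q k i : ℂ) • (1 : BOp) else 0 := by
  refine (hasSum_regTrace hq0 hq1 _).unique ?_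
  simp only [compress_reg_monomial]
  split_ifs with h
  · simp only [smul_smul]
    refine HasSum.smul_const ?_ _
    exact_mod_cast (hasSum_regWeight hq0 hq1 k i)
  · simp

/-- The slice map on bounded functions defined by the regular representation. -/
def sliceFun : BFun (SUqCommPair q) →L[ℂ] BFun (SUqPair q) :=
  LinearMap.mkContinuous
    { toFun := fun T => BoundedContinuousFunction.ofNormedAddCommGroupDiscrete
        (fun i => regTrace hq0 hq1 (regConj.symm (T (regCommPair hq0 hq1 i))))
        (‖regTrace hq0 hq1‖ * ‖T‖) fun i =>
          ((regTrace hq0 hq1).le_opNorm _).trans <| mul_le_mul_of_nonneg_left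
            ((norm_regConj_symm_le _).trans (BoundedContinuousFunction.norm_coe_le_norm _ _))
            (regTrace hq0 hq1).opNorm_nonneg
      map_add' := fun S T => BFun.ext fun i => by
        change regTrace hq0 hq1 (regConj.symm (S _ + T _)) = regTrace hq0 hq1 (regConj.symm (S _)) +
          regTrace hq0 hq1 (regConj.symm (T _))
        rw [map_add, map_add]
      map_smul' := fun r T => BFun.ext fun i => by
        change regTrace hq0 hq1 (regConj.symm (r • T _)) = r • regTrace hq0 hq1 (regConj.symm (T _))
        rw [map_smul, map_smul] }
    ‖regTrace hq0 hq1‖ fun T =>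
      (BoundedContinuousFunction.norm_le (by positivity)).2 fun i =>
        ((regTrace hq0 hq1).le_opNorm _).trans <| mul_le_mul_of_nonneg_left
          ((norm_regConj_symm_le _).trans (BoundedContinuousFunction.norm_coe_le_norm _ _))
          (regTrace hq0 hq1).opNorm_nonneg

theorem sliceFun_apply (T : BFun (SUqCommPair q)) (i : SUqPair q) :
    sliceFun hq0 hq1 T i = regTrace hq0 hq1 (regConj.symm (T (regCommPair hq0 hq1 i))) := rfl

end

/-! ### Density of monomials and of elementary tensors -/

namespace SUqRel

variable {B : Type*} [Ring B] [StarRing B] [Algebra ℂ B] [StarModule ℂ B] {q : ℝ} {a c : B}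

theorem a_c_pow (h : SUqRel q a c) (k : ℕ) : a * c ^ k = (q : ℂ) ^ k • (c ^ k * a) := by
  induction k with
  | zero => simp
  | succ k ih =>
    rw [pow_succ, ← mul_assoc, ih, smul_mul_assoc, mul_assoc, h.ac, mul_smul_comm, smul_smul,
      pow_succ, mul_assoc]

theorem c_pow_a' (h : SUqRel q a c) (k : ℕ) :
    c ^ k * star a = (q : ℂ) ^ k • (star a * c ^ k) := by
  induction k with
  | zero => simp
  | succ k ih =>
    rw [pow_succ', mul_assoc, ih, mul_smul_comm, h.c_a'_mul, smul_smul, pow_succ]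

theorem a_pow_c' (h : SUqRel q a c) (i : ℕ) :
    a ^ i * star c = (q : ℂ) ^ i • (star c * a ^ i) := by
  induction i with
  | zero => simp
  | succ i ih =>
    rw [pow_succ', mul_assoc, ih, mul_smul_comm, h.a_c'_mul, smul_smul, pow_succ]

theorem c'_a'_pow (h : SUqRel q a c) (j : ℕ) :
    star c * star a ^ j = (q : ℂ) ^ j • (star a ^ j * star c) := by
  induction j with
  | zero => simp
  | succ j ih =>
    rw [pow_succ, ← mul_assoc, ih, smul_mul_assoc, mul_assoc, h.c'_a', mul_smul_comm, smul_smul,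
      mul_assoc, pow_succ]

/-- The span of the monomials `γ ^ k * α ^ i * (γ ^ l * α ^ j)⋆`. -/
def _root_.monomialSpan (a c : B) : Submodule ℂ B :=
  Submodule.span ℂ (Set.range fun p : (ℕ × ℕ) × ℕ × ℕ =>
    c ^ p.1.1 * a ^ p.1.2 * star (c ^ p.2.1 * a ^ p.2.2))

theorem _root_.monomial_mem (a c : B) (k i l j : ℕ) :
    c ^ k * a ^ i * (star a ^ j * star c ^ l) ∈ monomialSpan a c :=
  Submodule.subset_span ⟨((k, i), (l, j)), by simp only [star_mul, star_pow]⟩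

/-- Normal ordering: a generator or its adjoint is moved past the powers of `c` and `a` to its
place. Moving adjoints to the right inverts the commutation relations, hence `q ≠ 0`. -/
theorem mul_mem_monomialSpan (h : SUqRel q a c) (hq : q ≠ 0) {g : B}
    (hg : g ∈ ({a, c} : Set B) ∪ star {a, c}) {x : B} (hx : x ∈ monomialSpan a c) :
    g * x ∈ monomialSpan a c := by
  have hq' : ∀ n : ℕ, (q : ℂ) ^ n ≠ 0 := fun n => pow_ne_zero _ (mod_cast hq)
  have hc' : ∀ k i l j : ℕ, c ^ k * (star c * (a ^ i * (star a ^ j * star c ^ l))) ∈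
      monomialSpan a c := fun k i l j => by
    have : star c * a ^ i = ((q : ℂ) ^ i)⁻¹ • (a ^ i * star c) := by
      rw [h.a_pow_c', inv_smul_smul₀ (hq' i)]
    rw [← mul_assoc (star c), this, smul_mul_assoc, mul_assoc, ← mul_assoc (star c), h.c'_a'_pow,
      smul_mul_assoc, mul_assoc, ← pow_succ']
    simp only [mul_smul_comm, smul_smul]
    rw [← mul_assoc]
    exact Submodule.smul_mem _ _ (monomial_mem a c _ _ _ _)
  induction hx using Submodule.span_induction with
  | zero => rw [mul_zero]; exact zero_mem _
  | add x y _ _ hx hy => rw [mul_add]; exact add_mem hx hy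
  | smul r x _ hx => rw [mul_smul_comm]; exact Submodule.smul_mem _ _ hx
  | mem x hx =>
    obtain ⟨⟨⟨k, i⟩, l, j⟩, rfl⟩ := hx
    simp only [star_mul, star_pow]
    simp only [Set.mem_union, Set.mem_insert_iff, Set.mem_singleton_iff, Set.mem_star] at hg
    rcases hg with (rfl | rfl) | hg | hg
    · rw [mul_assoc, ← mul_assoc g, h.a_c_pow, smul_mul_assoc, mul_assoc, ← mul_assoc g,
        ← pow_succ', ← mul_assoc]
      exact Submodule.smul_mem _ _ (monomial_mem _ _ _ _ _ _)
    · rw [mul_assoc, ← mul_assoc g, ← pow_succ', ← mul_assoc]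
      exact monomial_mem _ _ _ _ _ _
    · obtain rfl : g = star a := by rw [← hg, star_star]
      have e : star a * c ^ k = ((q : ℂ) ^ k)⁻¹ • (c ^ k * star a) := by
        rw [h.c_pow_a', inv_smul_smul₀ (hq' k)]
      rw [mul_assoc, ← mul_assoc (star a), e, smul_mul_assoc]
      refine Submodule.smul_mem _ _ ?_
      cases i with
      | zero =>
        have := monomial_mem a c k 0 l (j + 1)
        simp only [pow_zero, mul_one, one_mul, pow_succ', mul_assoc] at this ⊢
        exact this
      -- Here `a⋆` meets a power of `a`; `a⋆a = 1 - c c⋆` removes both and leaves a correction with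
      -- one `c` and one `c⋆` more, handled by `hc'`.
      | succ i =>
        rw [pow_succ', mul_assoc, mul_assoc, h.a'_a_mul, mul_sub, ← mul_assoc (c ^ k) c, ← pow_succ]
        refine sub_mem ?_ (hc' _ _ _ _)
        rw [← mul_assoc]
        exact monomial_mem _ _ _ _ _ _
    · obtain rfl : g = star c := by rw [← hg, star_star]
      have e : Commute (star c) (c ^ k) := (show Commute (star c) c from h.cc'.symm).pow_right k
      rw [mul_assoc, ← mul_assoc (star c), e.eq, mul_assoc]
      exact hc' _ _ _ _

theorem adjoin_le_monomialSpan (h : SUqRel q a c) (hq : q ≠ 0) {x : B}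
    (hx : x ∈ StarAlgebra.adjoin ℂ {a, c}) : x ∈ monomialSpan a c := by
  have key : ∀ x ∈ Algebra.adjoin ℂ (({a, c} : Set B) ∪ star {a, c}),
      ∀ y ∈ monomialSpan a c, x * y ∈ monomialSpan a c := by
    intro x hx
    induction hx using Algebra.adjoin_induction with
    | mem x hx => exact fun y hy => h.mul_mem_monomialSpan hq hx hy
    | algebraMap r =>
      intro y hy
      rw [← Algebra.smul_def]
      exact Submodule.smul_mem _ _ hy
    | add x y _ _ hx hy => intro z hz; rw [add_mul]; exact add_mem (hx z hz) (hy z hz)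
    | mul x y _ _ hx hy => intro z hz; rw [mul_assoc]; exact hx _ (hy z hz)
  have h1 : (1 : B) ∈ monomialSpan a c := by simpa using monomial_mem a c 0 0 0 0
  simpa using key x (by rwa [← StarAlgebra.adjoin_toSubalgebra]) 1 h1

end SUqRel

theorem dense_of_image_dense {X : Type*} [TopologicalSpace X] {S s : Set X} {t : Set S}
    (hS : S ⊆ closure s) (hst : s ⊆ Subtype.val '' t) : Dense t := fun x =>
  closure_subtype.2 (closure_mono hst (hS x.2))

theorem dense_monomialSpan {q : ℝ} (hq : q ≠ 0) :
    Dense (monomialSpan (suqAlpha q) (suqGamma q) : Set (ASU q)) := by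
  have hrel : SUqRel q (genAlpha q) (genGamma q) := (suq_rel q).map (SUqAlg q).subtype
  refine dense_of_image_dense (S := (SUqAlg q : Set (BFun (SUqPair q))))
    (s := (StarAlgebra.adjoin ℂ {genAlpha q, genGamma q} : StarSubalgebra ℂ (BFun (SUqPair q))))
    (fun x hx => hx) fun x hx => ?_
  have := hrel.adjoin_le_monomialSpan hq hx
  have e : monomialSpan (genAlpha q) (genGamma q) = (monomialSpan (suqAlpha q) (suqGamma q)).map
      (SUqAlg q).subtype.toAlgHom.toLinearMap := by
    rw [monomialSpan, monomialSpan, Submodule.map_span, ← Set.range_comp]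
    rfl
  rw [e] at this
  exact this

theorem ext_monomial {q : ℝ} (hq : q ≠ 0) {X : Type*} [AddCommMonoid X] [Module ℂ X]
    [TopologicalSpace X] [T2Space X] {f g : ASU q →L[ℂ] X}
    (h : ∀ k i l j : ℕ, f (suqGamma q ^ k * suqAlpha q ^ i * star (suqGamma q ^ l * suqAlpha q ^ j)) =
      g (suqGamma q ^ k * suqAlpha q ^ i * star (suqGamma q ^ l * suqAlpha q ^ j))) : f = g := by
  refine ContinuousLinearMap.ext_on (dense_monomialSpan hq) ?_
  rintro _ ⟨⟨⟨k, i⟩, l, j⟩, rfl⟩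
  exact h k i l j

/-- Centralizers are closed *-subalgebras, so commutation passes from generators to the generated
C⋆-algebra, one leg at a time. -/
theorem commute_inLeft_inRight {q : ℝ} (a b : ASU q) : Commute (inLeft q a) (inRight q b) := by
  have hcl : ∀ S : Set (BFun (SUqCommPair q)),
      IsClosed (StarSubalgebra.centralizer ℂ S : Set (BFun (SUqCommPair q))) := fun S => by
    rw [StarSubalgebra.coe_centralizer]; exact Set.isClosed_centralizer _
  have h1 : SUqAlg q ≤ (StarSubalgebra.centralizer ℂ {reindex SUqCommPair.snd (genAlpha q),
      reindex SUqCommPair.snd (genGamma q)}).comap (reindex SUqCommPair.fst) := by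
    refine StarSubalgebra.topologicalClosure_minimal (StarAlgebra.adjoin_le ?_)
      ((hcl _).preimage (continuous_reindex _))
    rintro _ (rfl | rfl) <;> refine (StarSubalgebra.mem_centralizer_iff ℂ).2 ?_ <;>
      rintro _ (rfl | rfl) <;> constructor <;> refine BFun.ext fun j => ?_
    exacts [j.comm.aa.symm.eq, j.comm.aa'.symm.eq, j.comm.ac.symm.eq, j.comm.ac'.symm.eq,
      j.comm.ca.symm.eq, j.comm.ca'.symm.eq, j.comm.cc.symm.eq, j.comm.cc'.symm.eq]
  have h2 : SUqAlg q ≤ (StarSubalgebra.centralizer ℂ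
      (reindex SUqCommPair.fst '' SUqAlg q)).comap (reindex SUqCommPair.snd) := by
    refine StarSubalgebra.topologicalClosure_minimal (StarAlgebra.adjoin_le ?_)
      ((hcl _).preimage (continuous_reindex _))
    have h3 : ∀ y ∈ ({reindex SUqCommPair.snd (genAlpha q), reindex SUqCommPair.snd (genGamma q)} :
        Set (BFun (SUqCommPair q))), ∀ x ∈ SUqAlg q,
        reindex SUqCommPair.fst x * y = y * reindex SUqCommPair.fst x := fun y hy x hx =>
      (((StarSubalgebra.mem_centralizer_iff ℂ).1 (h1 hx) y hy).1).symm
    rintro _ (rfl | rfl) <;> refine (StarSubalgebra.mem_centralizer_iff ℂ).2 ?_ <;>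
      rintro _ ⟨x, hx, rfl⟩ <;> refine ⟨h3 _ (by simp) x hx, ?_⟩ <;> rw [← map_star]
    exacts [h3 _ (by simp) _ (star_mem hx), h3 _ (by simp) _ (star_mem hx)]
  exact Subtype.ext ((StarSubalgebra.mem_centralizer_iff ℂ).1 (h2 b.2) _ ⟨a.1, a.2, rfl⟩).1

theorem tmulSU_mul {q : ℝ} (a b a' b' : ASU q) :
    tmulSU a b * tmulSU a' b' = tmulSU (a * a') (b * b') := by
  rw [tmulSU, tmulSU, tmulSU, map_mul, map_mul, mul_assoc, mul_assoc, ← mul_assoc (inRight q b),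
    ← (commute_inLeft_inRight a' b).eq, mul_assoc]

theorem dense_span_tmulSU (q : ℝ) :
    Dense (Submodule.span ℂ (Set.range fun p : ASU q × ASU q => tmulSU p.1 p.2) :
      Set (ASUTensor q)) := by
  set M := Submodule.span ℂ (Set.range fun p : ASU q × ASU q => tmulSU p.1 p.2) with hM
  have hmem : ∀ a b : ASU q, tmulSU a b ∈ M := fun a b => Submodule.subset_span ⟨(a, b), rfl⟩
  have hmul : ∀ x ∈ M, ∀ y ∈ M, x * y ∈ M := by
    intro x hx y hy
    induction hx using Submodule.span_induction with
    | zero => rw [zero_mul]; exact zero_mem _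
    | add x x' _ _ hx hx' => rw [add_mul]; exact add_mem hx hx'
    | smul r x _ hx => rw [smul_mul_assoc]; exact Submodule.smul_mem _ _ hx
    | mem x hx =>
      obtain ⟨p, rfl⟩ := hx
      induction hy using Submodule.span_induction with
      | zero => rw [mul_zero]; exact zero_mem _
      | add x x' _ _ hx hx' => rw [mul_add]; exact add_mem hx hx'
      | smul r x _ hx => rw [mul_smul_comm]; exact Submodule.smul_mem _ _ hx
      | mem y hy =>
        obtain ⟨p', rfl⟩ := hy
        rw [tmulSU_mul]
        exact hmem _ _
  have hl : ∀ a : ASU q, inLeft q a ∈ M := fun a => by simpa [tmulSU] using hmem a 1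
  have hr : ∀ a : ASU q, inRight q a ∈ M := fun a => by simpa [tmulSU] using hmem 1 a
  refine dense_of_image_dense (S := (SUqTensor q : Set (BFun (SUqCommPair q))))
    (s := (StarAlgebra.adjoin ℂ
      {reindex SUqCommPair.fst (genAlpha q), reindex SUqCommPair.fst (genGamma q),
        reindex SUqCommPair.snd (genAlpha q), reindex SUqCommPair.snd (genGamma q)} :
      StarSubalgebra ℂ (BFun (SUqCommPair q))))
    (fun x hx => hx) fun x hx => ?_
  rw [SetLike.mem_coe, ← StarSubalgebra.mem_toSubalgebra, StarAlgebra.adjoin_toSubalgebra] at hx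
  induction hx using Algebra.adjoin_induction with
  | mem x hx =>
    rcases hx with (rfl | rfl | rfl | rfl) | hx
    · exact ⟨_, hl (suqAlpha q), rfl⟩
    · exact ⟨_, hl (suqGamma q), rfl⟩
    · exact ⟨_, hr (suqAlpha q), rfl⟩
    · exact ⟨_, hr (suqGamma q), rfl⟩
    · rw [← star_star x]
      rcases hx with hx | hx | hx | hx <;> rw [hx]
      · exact ⟨_, hl (star (suqAlpha q)), rfl⟩
      · exact ⟨_, hl (star (suqGamma q)), rfl⟩
      · exact ⟨_, hr (star (suqAlpha q)), rfl⟩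
      · exact ⟨_, hr (star (suqGamma q)), rfl⟩
  | algebraMap r =>
    refine ⟨r • 1, M.smul_mem r (by simpa using hl 1), ?_⟩
    rw [Algebra.algebraMap_eq_smul_one]; rfl
  | add x y _ _ hx hy =>
    obtain ⟨x, hx, rfl⟩ := hx
    obtain ⟨y, hy, rfl⟩ := hy
    exact ⟨x + y, add_mem hx hy, rfl⟩
  | mul x y _ _ hx hy =>
    obtain ⟨x, hx, rfl⟩ := hx
    obtain ⟨y, hy, rfl⟩ := hy
    exact ⟨x * y, hmul x hx y hy, rfl⟩

theorem ext_tmulSU {q : ℝ} {X : Type*} [AddCommMonoid X] [Module ℂ X]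
    [TopologicalSpace X] [T2Space X] {f g : ASUTensor q →L[ℂ] X}
    (h : ∀ a b, f (tmulSU a b) = g (tmulSU a b)) : f = g := by
  refine ContinuousLinearMap.ext_on (dense_span_tmulSU q) ?_
  rintro _ ⟨⟨a, b⟩, rfl⟩
  exact h a b

/-! ### The Haar functional -/

/-- A *-homomorphism of C*-algebras as a continuous linear map. -/
def StarAlgHom.toCLM {A B : Type*} [CStarAlgebra A] [CStarAlgebra B] (φ : A →⋆ₐ[ℂ] B) :
    A →L[ℂ] B :=
  LinearMap.mkContinuous φ.toAlgHom.toLinearMap 1 fun x => by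
    rw [one_mul]; exact NonUnitalStarAlgHom.norm_apply_le φ x

theorem StarAlgHom.toCLM_apply {A B : Type*} [CStarAlgebra A] [CStarAlgebra B] (φ : A →⋆ₐ[ℂ] B)
    (x : A) : φ.toCLM x = φ x := rfl

theorem ASU.hom_ext {q : ℝ} (hq : q ≠ 0) {B : Type*} [CStarAlgebra B] {φ ψ : ASU q →⋆ₐ[ℂ] B}
    (ha : φ (suqAlpha q) = ψ (suqAlpha q)) (hc : φ (suqGamma q) = ψ (suqGamma q)) : φ = ψ := by
  have : φ.toCLM = ψ.toCLM := ext_monomial hq fun k i l j => by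
    simp only [StarAlgHom.toCLM_apply, map_mul, map_pow, map_star, ha, hc]
  exact StarAlgHom.ext fun x => DFunLike.congr_fun this x

/-- Evaluation at a representation. -/
def BFun.eval {I : Type} [TopologicalSpace I] (i : I) : BFun I →⋆ₐ[ℂ] BOp where
  toFun x := x i
  map_one' := rfl
  map_mul' _ _ := rfl
  map_zero' := rfl
  map_add' _ _ := rfl
  commutes' _ := rfl
  map_star' _ := rfl

/-- The representation of `A_q(SU(2))` defined by a pair. -/
def ASU.eval {q : ℝ} (i : SUqPair q) : ASU q →⋆ₐ[ℂ] BOp := (BFun.eval i).comp (SUqAlg q).subtype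

theorem ASU.ext_eval {q : ℝ} {x y : ASU q} (h : ∀ i, ASU.eval i x = ASU.eval i y) : x = y :=
  Subtype.ext (BFun.ext h)

section

variable {q : ℝ} (hq0 : 0 < q) (hq1 : q < 1)

/-- Two *-homomorphisms agreeing on `α` and `γ` coincide. -/
theorem eval_regCommPair_fst (i : SUqPair q) (x : ASU q) :
    ASU.eval (regCommPair hq0 hq1 i).fst x = regConj (regAmplify (ASU.eval i x)) := by
  have : ASU.eval (regCommPair hq0 hq1 i).fst =
      (regConj : (RegSpace →L[ℂ] RegSpace) →⋆ₐ[ℂ] BOp).comp (regAmplify.comp (ASU.eval i)) :=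
    ASU.hom_ext hq0.ne' rfl rfl
  rw [this]; rfl

/-- The regular representation of `A_q(SU(2))`. -/
def regRep : ASU q →⋆ₐ[ℂ] (RegSpace →L[ℂ] RegSpace) :=
  (regConj.symm : BOp →⋆ₐ[ℂ] (RegSpace →L[ℂ] RegSpace)).comp (ASU.eval (regPair hq0 hq1))

theorem regRep_alpha : regRep hq0 hq1 (suqAlpha q) = regAlpha q :=
  regConj.symm_apply_apply (regAlpha q)

theorem regRep_gamma : regRep hq0 hq1 (suqGamma q) = regGamma hq0 hq1 :=
  regConj.symm_apply_apply (regGamma hq0 hq1)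

/-- The operator valued Haar functional. -/
def haarOp : ASU q →L[ℂ] BOp := (regTrace hq0 hq1).comp (regRep hq0 hq1).toCLM

theorem haarOp_monomial (k i l j : ℕ) :
    haarOp hq0 hq1 (suqGamma q ^ k * suqAlpha q ^ i * star (suqGamma q ^ l * suqAlpha q ^ j)) =
      if k = l ∧ i = j then (haarWeight q k i : ℂ) • (1 : BOp) else 0 := by
  rw [← regTrace_monomial hq0 hq1]
  change regTrace hq0 hq1 (regRep hq0 hq1 _) = _
  simp only [map_mul, map_pow, map_star, regRep_alpha, regRep_gamma]

/-- The Haar functional. -/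
def haar : ASU q →L[ℂ] ℂ :=
  (innerSL ℂ (lp.single 2 0 1 : lp (fun _ : ℕ => ℂ) 2)).comp
    ((ContinuousLinearMap.apply ℂ _ (lp.single 2 0 1 : lp (fun _ : ℕ => ℂ) 2)).comp
      (haarOp hq0 hq1))

theorem haar_apply (x : ASU q) : haar hq0 hq1 x = inner ℂ (lp.single 2 0 1 : lp (fun _ : ℕ => ℂ) 2)
    (haarOp hq0 hq1 x (lp.single 2 0 1)) := rfl

theorem haar_monomial (k i l j : ℕ) :
    haar hq0 hq1 (suqGamma q ^ k * suqAlpha q ^ i * star (suqGamma q ^ l * suqAlpha q ^ j)) =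
      if k = l ∧ i = j then (haarWeight q k i : ℂ) else 0 := by
  rw [haar_apply, haarOp_monomial]
  split_ifs
  · rw [smul_apply, one_apply_eq_self, inner_smul_right, lp.inner_single_left,
      lp.single_apply_self]
    simp
  · rw [zero_apply, inner_zero_right]

/-- The weighted trace takes scalar values on monomials, hence everywhere by density. No information
is lost by taking one matrix entry in the definition of `haar`. -/
theorem haarOp_eq (x : ASU q) : haarOp hq0 hq1 x = haar hq0 hq1 x • 1 := by
  have : haarOp hq0 hq1 = (haar hq0 hq1).smulRight (1 : BOp) := ext_monomial hq0.ne' fun k i l j => by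
    rw [ContinuousLinearMap.smulRight_apply, haarOp_monomial, haar_monomial]
    split_ifs <;> simp
  exact DFunLike.congr_fun this x

theorem haar_one : haar hq0 hq1 1 = 1 := by
  simpa [haarWeight_zero_zero hq0 hq1] using haar_monomial hq0 hq1 0 0 0 0

theorem sliceFun_tmulSU (a b : ASU q) :
    sliceFun hq0 hq1 (tmulSU a b).1 = haar hq0 hq1 b • a.1 := by
  refine BFun.ext fun i => ?_
  rw [sliceFun_apply]
  change regTrace hq0 hq1 (regConj.symm (ASU.eval (regCommPair hq0 hq1 i).fst a *
    ASU.eval (regPair hq0 hq1) b)) = haar hq0 hq1 b • ASU.eval i a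
  rw [map_mul, eval_regCommPair_fst, StarAlgEquiv.symm_apply_apply, regTrace_amplify_mul]
  change _ * haarOp hq0 hq1 b = _
  rw [haarOp_eq, mul_smul_comm, mul_one]

theorem sliceFun_mem (T : ASUTensor q) : sliceFun hq0 hq1 T.1 ∈ SUqAlg q := by
  have hcl : IsClosed {T : ASUTensor q | sliceFun hq0 hq1 T.1 ∈ SUqAlg q} :=
    (StarSubalgebra.isClosed_topologicalClosure _).preimage
      ((sliceFun hq0 hq1).continuous.comp continuous_subtype_val)
  refine hcl.closure_subset_iff.2 ?_ (dense_span_tmulSU q T)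
  intro x hx
  induction hx using Submodule.span_induction with
  | zero =>
    change sliceFun hq0 hq1 0 ∈ SUqAlg q
    rw [map_zero]; exact zero_mem _
  | add x y _ _ hx hy =>
    change sliceFun hq0 hq1 (x.1 + y.1) ∈ SUqAlg q
    rw [map_add]; exact add_mem hx hy
  | smul r x _ hx =>
    change sliceFun hq0 hq1 (r • x.1) ∈ SUqAlg q
    rw [map_smul]; exact (SUqAlg q).smul_mem hx r
  | mem x hx =>
    obtain ⟨p, rfl⟩ := hx
    change sliceFun hq0 hq1 (tmulSU p.1 p.2).1 ∈ SUqAlg q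
    rw [sliceFun_tmulSU]
    exact (SUqAlg q).smul_mem p.1.2 _

/-- The slice map `id ⊗ h` of the Haar functional. -/
def haarSlice : ASUTensor q →L[ℂ] ASU q :=
  ((sliceFun hq0 hq1).comp (Submodule.subtypeL (SUqTensor q).toSubalgebra.toSubmodule)).codRestrict
    (SUqAlg q).toSubalgebra.toSubmodule fun T => sliceFun_mem hq0 hq1 T

theorem haarSlice_tmulSU (a b : ASU q) :
    haarSlice hq0 hq1 (tmulSU a b) = haar hq0 hq1 b • a :=
  Subtype.ext (sliceFun_tmulSU hq0 hq1 a b)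

end

/-! ### Comultiplication of monomials and right invariance. -/

theorem tmulSU_smul_left {q : ℝ} (r : ℂ) (a b : ASU q) : tmulSU (r • a) b = r • tmulSU a b := by
  rw [tmulSU, map_smul, smul_mul_assoc, tmulSU]

theorem tmulSU_smul_right {q : ℝ} (r : ℂ) (a b : ASU q) : tmulSU a (r • b) = r • tmulSU a b := by
  rw [tmulSU, map_smul, mul_smul_comm, tmulSU]

theorem tmulSU_add_left {q : ℝ} (a a' b : ASU q) :
    tmulSU (a + a') b = tmulSU a b + tmulSU a' b := by
  rw [tmulSU, map_add, add_mul, tmulSU, tmulSU]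

theorem tmulSU_sub_left {q : ℝ} (a a' b : ASU q) :
    tmulSU (a - a') b = tmulSU a b - tmulSU a' b := by
  rw [tmulSU, map_sub, sub_mul, tmulSU, tmulSU]

theorem tmulSU_zero_left {q : ℝ} (b : ASU q) : tmulSU 0 b = 0 := by
  rw [tmulSU, map_zero, zero_mul]

theorem star_tmulSU {q : ℝ} (a b : ASU q) : star (tmulSU a b) = tmulSU (star a) (star b) := by
  rw [tmulSU, star_mul, ← map_star, ← map_star, ← (commute_inLeft_inRight _ _).eq, tmulSU]

theorem tmulSU_one_one (q : ℝ) : tmulSU (1 : ASU q) 1 = 1 := by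
  rw [tmulSU, map_one, map_one, mul_one]

theorem comult_alpha_pow (q : ℝ) (m : ℕ) : comult q (suqAlpha q ^ m) =
    ∑ j ∈ Finset.range (m + 1), tmulSU (matCoeff q (suqAlpha q) (suqGamma q) m 0 j)
      (suqGamma q ^ j * suqAlpha q ^ (m - j)) := by
  induction m with
  | zero => simp [matCoeff, tmulSU_one_one]
  | succ m ih =>
    rw [pow_succ', map_mul, ih, comult_alpha, sub_mul, smul_mul_assoc, Finset.mul_sum,
      Finset.mul_sum]
    simp only [matCoeff, tmulSU_sub_left, Finset.sum_sub_distrib]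
    congr 1
    · rw [Finset.sum_range_succ _ (m + 1), matCoeff_eq_zero _ _ _ _ _ _ (Nat.lt_succ_self m),
        mul_zero, smul_zero, tmulSU_zero_left, add_zero]
      refine Finset.sum_congr rfl fun j hj => ?_
      rw [tmulSU_mul, ← mul_assoc (suqAlpha q), (suq_rel q).a_c_pow, smul_mul_assoc, mul_assoc,
        ← pow_succ', tmulSU_smul_right, tmulSU_smul_left,
        Nat.sub_add_comm (Nat.lt_succ_iff.1 (Finset.mem_range.1 hj))]
    · rw [Finset.sum_range_succ' _ (m + 1), seqShift_zero, mul_zero, smul_zero, tmulSU_zero_left,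
        add_zero, Finset.smul_sum]
      refine Finset.sum_congr rfl fun j hj => ?_
      rw [tmulSU_mul, tmulSU_smul_left, seqShift_succ, Nat.add_sub_add_right, ← mul_assoc (suqGamma q),
        ← pow_succ']

/-- Multiply by `Δγ = γ ⊗ α + α⋆ ⊗ γ` on the left: in the second leg `α` passes `γ^j` at the cost of
`q^j`, and `γ` raises `j` by one. This is the recursion that defines `matCoeff`. -/
theorem comult_monomial (q : ℝ) (k l : ℕ) : comult q (suqGamma q ^ k * suqAlpha q ^ l) =
    ∑ j ∈ Finset.range (k + l + 1), tmulSU (matCoeff q (suqAlpha q) (suqGamma q) (k + l) k j)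
      (suqGamma q ^ j * suqAlpha q ^ (k + l - j)) := by
  induction k with
  | zero => simpa using comult_alpha_pow q l
  | succ k ih =>
    rw [pow_succ', mul_assoc, map_mul, ih, comult_gamma, add_mul, Finset.mul_sum,
      Finset.mul_sum, show k + 1 + l = k + l + 1 by omega]
    generalize k + l = m
    simp only [matCoeff, tmulSU_add_left, Finset.sum_add_distrib]
    congr 1
    · rw [Finset.sum_range_succ _ (m + 1), matCoeff_eq_zero _ _ _ _ _ _ (Nat.lt_succ_self m),
        mul_zero, smul_zero, tmulSU_zero_left, add_zero]
      refine Finset.sum_congr rfl fun j hj => ?_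
      rw [tmulSU_mul, ← mul_assoc (suqAlpha q), (suq_rel q).a_c_pow, smul_mul_assoc, mul_assoc,
        ← pow_succ', tmulSU_smul_right, tmulSU_smul_left,
        Nat.sub_add_comm (Nat.lt_succ_iff.1 (Finset.mem_range.1 hj))]
    · rw [Finset.sum_range_succ' _ (m + 1), seqShift_zero, mul_zero, tmulSU_zero_left, add_zero]
      refine Finset.sum_congr rfl fun j hj => ?_
      rw [tmulSU_mul, seqShift_succ, Nat.add_sub_add_right, ← mul_assoc (suqGamma q), ← pow_succ']

theorem haarSlice_comult {q : ℝ} (hq0 : 0 < q) (hq1 : q < 1) (x : ASU q) :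
    haarSlice hq0 hq1 (comult q x) = haar hq0 hq1 x • 1 := by
  have : (haarSlice hq0 hq1).comp (comult q).toCLM = (haar hq0 hq1).smulRight (1 : ASU q) := by
    refine ext_monomial hq0.ne' fun k i l j => ?_
    rw [ContinuousLinearMap.smulRight_apply, haar_monomial, ContinuousLinearMap.comp_apply,
      StarAlgHom.toCLM_apply, map_mul, map_star, comult_monomial, comult_monomial]
    simp only [star_sum, star_tmulSU, Finset.sum_mul, Finset.mul_sum, tmulSU_mul, map_sum,
      haarSlice_tmulSU, haar_monomial]
    -- Equal degrees reduce to the orthogonality relations. In different degrees no pair of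
    -- monomials can have both exponents equal, so every term is zero.
    by_cases hm : k + i = l + j
    · rw [← hm]
      have h1 := (suq_rel q).matCoeff_orthogonal hq0 hq1 (k + i) k l (by omega) (by omega)
      rw [show k + i - k = i by omega] at h1
      have h2 : ∀ r ∈ Finset.range (k + i + 1), ∀ s ∈ Finset.range (k + i + 1),
          ((r = s ∧ k + i - r = k + i - s) ↔ r = s) := fun r _ s _ => by
        constructor
        · exact fun h => h.1
        · rintro rfl; exact ⟨rfl, rfl⟩
      have h3 : (k = l ∧ i = j) ↔ k = l := by omega
      rw [ite_smul, zero_smul, if_congr h3 rfl rfl, ← h1]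
      refine Finset.sum_congr rfl fun r hr => ?_
      rw [Finset.sum_eq_single r]
      · rw [if_pos ⟨rfl, rfl⟩]
      · intro s hs hsr
        rw [if_neg (fun h => hsr (by omega)), zero_smul]
      · exact fun h => absurd hr h
    · rw [if_neg (by omega), zero_smul]
      refine Finset.sum_eq_zero fun r hr => Finset.sum_eq_zero fun s hs => ?_
      rw [Finset.mem_range] at hr hs
      rw [if_neg (by omega), zero_smul]
  exact DFunLike.congr_fun this x

/-! ### Left invariance and uniqueness -/

theorem SUqPair.ext_fields {q : ℝ} {i j : SUqPair q} (ha : i.a = j.a) (hc : i.c = j.c) :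
    i = j := by
  cases i; cases j; cases ha; cases hc; rfl

theorem SUqRel.neg_star {B : Type*} [Ring B] [StarRing B] [Algebra ℂ B] [StarModule ℂ B] {q : ℝ}
    {a c : B} (h : SUqRel q a c) : SUqRel q a (-star c) := by
  constructor
  · rw [mul_neg, h.ac', neg_mul, smul_neg]
  · rw [star_neg, star_star, mul_neg, h.ac, neg_mul, smul_neg]
  · rw [star_neg, star_star, neg_mul_neg, neg_mul_neg, h.cc']
  · rw [star_neg, star_star, neg_mul_neg, h.cc', h.sphere]
  · rw [star_neg, star_star, neg_mul_neg, ← h.cc', h.sphere']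

section

variable {q : ℝ}

/-- The involution `(a, c) ↦ (a, -c⋆)` on representations. -/
def SUqPair.theta (i : SUqPair q) : SUqPair q := ⟨i.a, -star i.c, i.rel.neg_star⟩

theorem SUqPair.theta_theta (i : SUqPair q) : i.theta.theta = i :=
  SUqPair.ext_fields rfl (by simp [SUqPair.theta])

theorem BFun.neg_apply {I : Type} [TopologicalSpace I] (x : BFun I) (i : I) : (-x) i = -x i := rfl

theorem BFun.star_apply {I : Type} [TopologicalSpace I] (x : BFun I) (i : I) :
    (star x) i = star (x i) := rfl

theorem reindex_theta_gamma (q : ℝ) :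
    reindex SUqPair.theta (genGamma q) = -star (genGamma q) := BFun.ext fun i => by
  rw [BFun.neg_apply, BFun.star_apply]; rfl

theorem suqTheta_mem (x : ASU q) : reindex SUqPair.theta x.1 ∈ SUqAlg q := by
  have : SUqAlg q ≤ (SUqAlg q).comap (reindex SUqPair.theta) := by
    refine StarSubalgebra.topologicalClosure_minimal (StarAlgebra.adjoin_le ?_)
      ((StarSubalgebra.isClosed_topologicalClosure _).preimage (continuous_reindex _))
    rintro x (rfl | rfl)
    · exact genAlpha_mem q
    · rw [SetLike.mem_coe, StarSubalgebra.mem_comap, reindex_theta_gamma]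
      exact neg_mem (star_mem (genGamma_mem q))
  exact this x.2

/-- The *-automorphism of `A_q(SU(2))` with `α ↦ α` and `γ ↦ -γ⋆`. -/
def suqTheta (q : ℝ) : ASU q →⋆ₐ[ℂ] ASU q :=
  ((reindex SUqPair.theta).comp (SUqAlg q).subtype).codRestrict (SUqAlg q) suqTheta_mem

theorem eval_suqTheta (x : ASU q) (i : SUqPair q) :
    ASU.eval i (suqTheta q x) = ASU.eval i.theta x := rfl

theorem suqTheta_suqTheta (x : ASU q) : suqTheta q (suqTheta q x) = x :=
  ASU.ext_eval fun i => by rw [eval_suqTheta, eval_suqTheta, SUqPair.theta_theta]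

/-- The involution `(π₁, π₂) ↦ (θ π₂, θ π₁)` on pairs of commuting representations. -/
def SUqCommPair.flip (j : SUqCommPair q) : SUqCommPair q where
  fst := j.snd.theta
  snd := j.fst.theta
  comm :=
    { aa := j.comm.aa.symm
      aa' := (by simpa using j.comm.aa'.star_star.symm : Commute j.snd.a (star j.fst.a))
      ac := (by simpa using j.comm.ca'.star_star.symm : Commute j.snd.a (star j.fst.c)).neg_right
      ac' := by
        rw [SUqPair.theta, SUqPair.theta, star_neg, star_star]
        exact j.comm.ca.symm.neg_right
      ca := (j.comm.ac'.symm).neg_left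
      ca' := j.comm.ac.star_star.symm.neg_left
      cc := j.comm.cc.star_star.symm.neg_left.neg_right
      cc' := by
        simp only [SUqPair.theta, star_neg, star_star]
        exact j.comm.cc'.symm.neg_left.neg_right }

/-- At the level of representations, this says that `suqTheta` reverses the order of the legs in the
comultiplication. -/
theorem SUqCommPair.prod_flip (j : SUqCommPair q) : j.flip.prod = j.prod.theta := by
  refine SUqPair.ext_fields ?_ ?_
  · simp only [SUqCommPair.prod, SUqCommPair.flip, SUqPair.theta, star_neg, star_star]
    have h : star j.fst.c * j.snd.c = j.snd.c * star j.fst.c := by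
      simpa using congrArg star j.comm.cc'.eq.symm
    rw [j.comm.aa.eq, h, neg_mul_neg]
  · simp only [SUqCommPair.prod, SUqCommPair.flip, SUqPair.theta, star_neg, star_star, star_add,
      star_mul]
    rw [neg_mul, mul_neg, neg_add, add_comm]

theorem reindex_flip_fst_gamma (q : ℝ) :
    reindex SUqCommPair.flip (reindex SUqCommPair.fst (genGamma q)) =
      -star (reindex SUqCommPair.snd (genGamma q)) := BFun.ext fun i => by
  rw [BFun.neg_apply, BFun.star_apply]; rfl

theorem reindex_flip_snd_gamma (q : ℝ) :
    reindex SUqCommPair.flip (reindex SUqCommPair.snd (genGamma q)) =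
      -star (reindex SUqCommPair.fst (genGamma q)) := BFun.ext fun i => by
  rw [BFun.neg_apply, BFun.star_apply]; rfl

theorem suqFlip_mem (x : ASUTensor q) : reindex SUqCommPair.flip x.1 ∈ SUqTensor q := by
  have : SUqTensor q ≤ (SUqTensor q).comap (reindex SUqCommPair.flip) := by
    refine StarSubalgebra.topologicalClosure_minimal (StarAlgebra.adjoin_le ?_)
      ((StarSubalgebra.isClosed_topologicalClosure _).preimage (continuous_reindex _))
    rintro x (rfl | rfl | rfl | rfl)
    · exact tensor_snd_alpha q
    · rw [SetLike.mem_coe, StarSubalgebra.mem_comap, reindex_flip_fst_gamma]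
      exact neg_mem (star_mem (tensor_snd_gamma q))
    · exact tensor_fst_alpha q
    · rw [SetLike.mem_coe, StarSubalgebra.mem_comap, reindex_flip_snd_gamma]
      exact neg_mem (star_mem (tensor_fst_gamma q))
  exact this x.2

/-- The *-automorphism `a ⊗ b ↦ θ b ⊗ θ a` of the tensor square. -/
def suqFlip (q : ℝ) : ASUTensor q →⋆ₐ[ℂ] ASUTensor q :=
  ((reindex SUqCommPair.flip).comp (SUqTensor q).subtype).codRestrict (SUqTensor q) suqFlip_mem

theorem suqFlip_tmulSU (a b : ASU q) :
    suqFlip q (tmulSU a b) = tmulSU (suqTheta q b) (suqTheta q a) := by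
  have h1 : suqFlip q (inLeft q a) = inRight q (suqTheta q a) := rfl
  have h2 : suqFlip q (inRight q b) = inLeft q (suqTheta q b) := rfl
  rw [tmulSU, map_mul, h1, h2, ← (commute_inLeft_inRight _ _).eq, tmulSU]

theorem suqFlip_comult (x : ASU q) : suqFlip q (comult q x) = comult q (suqTheta q x) :=
  Subtype.ext (BFun.ext fun j => congrArg (fun i => x.1 i) j.prod_flip)

/-- Evaluate `(h' ⊗ h)Δ(x)` in both orders: slicing with `h` first leaves `h(x)`, slicing with `h'`
first leaves `h'(x)`. -/
theorem eq_of_left_right_inv {h h' : ASU q →L[ℂ] ℂ} (h1 : h 1 = 1) (h1' : h' 1 = 1)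
    (hr : ∃ S, IsSliceRight h S ∧ ∀ a, S (comult q a) = h a • (1 : ASU q))
    (hl : ∃ S, IsSliceLeft h' S ∧ ∀ a, S (comult q a) = h' a • (1 : ASU q)) : h = h' := by
  obtain ⟨S, hS, hSi⟩ := hr
  obtain ⟨S', hS', hSi'⟩ := hl
  have key : h'.comp S = h.comp S' := ext_tmulSU fun a b => by
    rw [ContinuousLinearMap.comp_apply, ContinuousLinearMap.comp_apply, hS, hS', map_smul, map_smul,
      smul_eq_mul, smul_eq_mul, mul_comm]
  ext x
  have := DFunLike.congr_fun key (comult q x)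
  rw [ContinuousLinearMap.comp_apply, ContinuousLinearMap.comp_apply, hSi, hSi', map_smul,
    map_smul, h1, h1', smul_eq_mul, smul_eq_mul, mul_one, mul_one] at this
  exact this

variable (hq0 : 0 < q) (hq1 : q < 1)

theorem haar_right_inv : ∃ S, IsSliceRight (haar hq0 hq1) S ∧
    ∀ a, S (comult q a) = haar hq0 hq1 a • (1 : ASU q) :=
  ⟨haarSlice hq0 hq1, haarSlice_tmulSU hq0 hq1, haarSlice_comult hq0 hq1⟩

theorem haar_theta_left_inv : ∃ S, IsSliceLeft ((haar hq0 hq1).comp (suqTheta q).toCLM) S ∧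
    ∀ a, S (comult q a) = (haar hq0 hq1).comp (suqTheta q).toCLM a • (1 : ASU q) := by
  refine ⟨(suqTheta q).toCLM.comp ((haarSlice hq0 hq1).comp (suqFlip q).toCLM), fun a b => ?_,
    fun a => ?_⟩
  all_goals simp only [ContinuousLinearMap.comp_apply, StarAlgHom.toCLM_apply]
  · rw [suqFlip_tmulSU, haarSlice_tmulSU, map_smul, suqTheta_suqTheta]
  · rw [suqFlip_comult, haarSlice_comult, map_smul, map_one]

theorem isHaarFunctional_haar : IsHaarFunctional q (haar hq0 hq1) where
  map_one := haar_one hq0 hq1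
  right_inv := haar_right_inv hq0 hq1
  left_inv := by
    have h := eq_of_left_right_inv (haar_one hq0 hq1)
      (h' := (haar hq0 hq1).comp (suqTheta q).toCLM)
      (by rw [ContinuousLinearMap.comp_apply, StarAlgHom.toCLM_apply, map_one, haar_one])
      (haar_right_inv hq0 hq1) (haar_theta_left_inv hq0 hq1)
    have := haar_theta_left_inv hq0 hq1
    rwa [← h] at this

theorem IsHaarFunctional.eq_haar {h : ASU q →L[ℂ] ℂ} (hh : IsHaarFunctional q h) :
    h = haar hq0 hq1 :=
  (eq_of_left_right_inv (haar_one hq0 hq1) hh.map_one (haar_right_inv hq0 hq1) hh.left_inv).symm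

end

/-! ### Factorizations of the spherical element -/

section

variable {B : Type*} [Ring B] [StarRing B] [Algebra ℂ B] [StarModule ℂ B] {q : ℝ} {a c : B}

/-- The spherical element, with parameter `w = i q ^ τ`. -/
def spherElt (a c : B) (w : ℂ) : B :=
  w • (star a * c - star c * a) - (1 + w ^ 2) • (star c * c)

namespace SUqRel

variable {w : ℂ}

/-- This and the next three identities write affine functions of `ρ_w` or `ρ_(qw)` as `b⋆b` or
`bb⋆`. They serve three purposes: bounds for the spectrum, passage between the parameters `w` and
`qw`, and the product formula for `spherVec`. -/
theorem one_add_spherElt (h : SUqRel q a c) (hw : star w = -w) :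
    star (a + w • c) * (a + w • c) = 1 + spherElt a c w := by
  rw [spherElt, star_add, star_smul, hw, add_mul, mul_add, mul_add, smul_mul_assoc, smul_mul_assoc,
    mul_smul_comm, mul_smul_comm, h.a'_a, h.cc']
  module

theorem one_add_smul_spherElt (h : SUqRel q a c) (hw : star w = -w) :
    (a + ((q : ℂ) * w) • c) * star (a + ((q : ℂ) * w) • c) = 1 + (q : ℂ) ^ 2 • spherElt a c w := by
  have hqw : star ((q : ℂ) * w) = -((q : ℂ) * w) := by
    rw [star_mul', hw, RCLike.star_def, Complex.conj_ofReal, mul_neg]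
  rw [spherElt, star_add, star_smul, hqw, add_mul, mul_add, mul_add, smul_mul_assoc, smul_mul_assoc,
    mul_smul_comm, mul_smul_comm, h.a_a', h.c_a', h.ac', h.cc']
  module

theorem neg_sq_sub_spherElt (h : SUqRel q a c) (hw : star w = -w) :
    star (c + w • a) * (c + w • a) = algebraMap ℂ B (-w ^ 2) - spherElt a c w := by
  rw [spherElt, star_add, star_smul, hw, add_mul, mul_add, mul_add, smul_mul_assoc, smul_mul_assoc,
    mul_smul_comm, mul_smul_comm, h.a'_a, h.cc', Algebra.algebraMap_eq_smul_one]
  module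

theorem neg_sq_sub_spherElt' (h : SUqRel q a c) (hw : star w = -w) :
    (c + w • a) * star (c + w • a) = algebraMap ℂ B (-w ^ 2) - spherElt a c ((q : ℂ) * w) := by
  rw [spherElt, star_add, star_smul, hw, add_mul, mul_add, mul_add, smul_mul_assoc, smul_mul_assoc,
    mul_smul_comm, mul_smul_comm, h.a_a', h.c_a', h.ac', h.cc', Algebra.algebraMap_eq_smul_one]
  module

/-- For `ξ = a + q w c` one has `ξ⋆ξ = 1 + ρ_(qw)` and `ξξ⋆ = 1 + q² ρ_w`; the claim is `ξ(ξ⋆ξ) =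
(ξξ⋆)ξ`. -/
theorem spherElt_intertwine (h : SUqRel q a c) (hw : star w = -w) :
    (a + ((q : ℂ) * w) • c) * spherElt a c ((q : ℂ) * w) =
      (q : ℂ) ^ 2 • (spherElt a c w * (a + ((q : ℂ) * w) • c)) := by
  have hqw : star ((q : ℂ) * w) = -((q : ℂ) * w) := by
    rw [star_mul', hw, RCLike.star_def, Complex.conj_ofReal, mul_neg]
  have h1 := congrArg ((a + ((q : ℂ) * w) • c) * ·) (h.one_add_spherElt hqw)
  have h2 := congrArg (· * (a + ((q : ℂ) * w) • c)) (h.one_add_smul_spherElt hw)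
  simp only [mul_assoc] at h1 h2
  rw [h1, mul_add _ (1 : B), add_mul (1 : B), one_mul, mul_one, smul_mul_assoc] at h2
  exact add_left_cancel h2

/-- The products `ξ₁ ⋯ ξₘ` with `ξⱼ = α + q ^ j w γ`. -/
def _root_.spherVec (q : ℝ) (a c : B) (w : ℂ) : ℕ → B
  | 0 => 1
  | m + 1 => spherVec q a c w m * (a + ((q : ℂ) ^ (m + 1) * w) • c)

theorem _root_.star_ofReal_pow_mul {w : ℂ} (hw : star w = -w) (q : ℝ) (m : ℕ) :
    star ((q : ℂ) ^ m * w) = -((q : ℂ) ^ m * w) := by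
  rw [star_mul', hw, star_pow, RCLike.star_def, Complex.conj_ofReal, mul_neg]

theorem spherVec_intertwine (h : SUqRel q a c) (hw : star w = -w) (m : ℕ) :
    spherVec q a c w m * spherElt a c ((q : ℂ) ^ m * w) =
      (q : ℂ) ^ (2 * m) • (spherElt a c w * spherVec q a c w m) := by
  induction m with
  | zero => simp [spherVec]
  | succ m ih =>
    have := h.spherElt_intertwine (star_ofReal_pow_mul hw q m)
    rw [← mul_assoc (q : ℂ), ← pow_succ'] at this
    rw [spherVec, mul_assoc, this, mul_smul_comm, ← mul_assoc, ih, smul_mul_assoc, smul_smul,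
      mul_assoc]
    ring_nf

open Polynomial in
/-- The polynomial `∏_{j = 1}^m (1 + r ^ j X)`. -/
def _root_.qPoch (r : ℝ) (m : ℕ) : Polynomial ℂ :=
  ∏ j ∈ Finset.range m, (1 + C ((r : ℂ) ^ (j + 1)) * X)

/-- The innermost factor `ξξ⋆` is `1 + q² ρ` at parameter `q^m w`; moving that `ρ` out through the
first `m` factors yields `1 + q^(2(m+1)) ρ_w` in front. -/
theorem spherVec_mul_star (h : SUqRel q a c) (hw : star w = -w) (m : ℕ) :
    spherVec q a c w m * star (spherVec q a c w m) =
      Polynomial.aeval (spherElt a c w) (qPoch (q ^ 2) m) := by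
  induction m with
  | zero => simp [spherVec, qPoch]
  | succ m ih =>
    have h1 := h.one_add_smul_spherElt (star_ofReal_pow_mul hw q m)
    rw [← mul_assoc (q : ℂ), ← pow_succ'] at h1
    rw [spherVec, star_mul, mul_assoc, ← mul_assoc (a + _), h1, add_mul, one_mul, mul_add, ih,
      smul_mul_assoc, mul_smul_comm, ← mul_assoc, h.spherVec_intertwine hw, smul_mul_assoc,
      smul_smul, mul_assoc, ih, qPoch, qPoch, Finset.prod_range_succ _ m, mul_comm (Finset.prod _ _),
      map_mul, map_add, map_one, map_mul, Polynomial.aeval_C, Polynomial.aeval_X, add_mul, one_mul,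
      Algebra.algebraMap_eq_smul_one, smul_mul_assoc, one_mul, smul_mul_assoc]
    congr 2
    push_cast
    ring

end SUqRel

/-- The coefficients of `∏_{j = 1}^m (1 + r ^ j X)`. -/
def qPochCoeff (r : ℝ) : ℕ → ℕ → ℝ
  | 0, 0 => 1
  | 0, _ + 1 => 0
  | m + 1, 0 => qPochCoeff r m 0
  | m + 1, k + 1 => qPochCoeff r m (k + 1) + r ^ (m + 1) * qPochCoeff r m k

theorem qPochCoeff_eq_zero (r : ℝ) {m k : ℕ} (hk : m < k) : qPochCoeff r m k = 0 := by
  induction m generalizing k with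
  | zero => cases k with
    | zero => omega
    | succ k => rfl
  | succ m ih => cases k with
    | zero => omega
    | succ k => rw [qPochCoeff, ih (by omega), ih (by omega), mul_zero, add_zero]

theorem qPochCoeff_zero (r : ℝ) (m : ℕ) : qPochCoeff r m 0 = 1 := by
  induction m with
  | zero => rfl
  | succ m ih => rw [qPochCoeff, ih]

theorem prod_eq_sum_qPochCoeff (r b : ℝ) (m : ℕ) :
    ∏ j ∈ Finset.range m, (1 + r ^ (j + 1) * b) =
      ∑ k ∈ Finset.range (m + 1), qPochCoeff r m k * b ^ k := by
  induction m with
  | zero => simp [qPochCoeff]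
  | succ m ih =>
    have h1 := Finset.sum_range_succ' (fun k => qPochCoeff r m k * b ^ k) (m + 1)
    rw [Finset.sum_range_succ, qPochCoeff_eq_zero r (Nat.lt_succ_self m)] at h1
    have h2 : ∑ k ∈ Finset.range (m + 1), r ^ (m + 1) * qPochCoeff r m k * b ^ (k + 1) =
        (∑ k ∈ Finset.range (m + 1), qPochCoeff r m k * b ^ k) * (r ^ (m + 1) * b) := by
      rw [Finset.sum_mul]
      exact Finset.sum_congr rfl fun k _ => by ring
    rw [Finset.prod_range_succ, ih, Finset.sum_range_succ' _ (m + 1)]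
    simp only [qPochCoeff, add_mul, Finset.sum_add_distrib]
    rw [h2]
    linear_combination h1

/-- The q-binomial theorem: the coefficient is `q^(k(k+1))` times the Gaussian binomial in base
`q²`, the power being written as the square of `∏ q^(i+1)`. The induction is the q-Pascal rule. -/
theorem qPochCoeff_mul_qFac {q : ℝ} (m k : ℕ) (hk : k ≤ m) :
    qPochCoeff (q ^ 2) m k * (qFac q k * qFac q (m - k)) =
      qFac q m * (∏ i ∈ Finset.range k, q ^ (i + 1)) ^ 2 := by
  induction m generalizing k with
  | zero =>
    obtain rfl : k = 0 := by omega
    simp [qPochCoeff, qFac]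
  | succ m ih =>
    cases k with
    | zero => simp [qPochCoeff_zero, qFac]
    | succ k =>
      rw [qPochCoeff, Nat.add_sub_add_right]
      have h1 := ih k (by omega)
      obtain ⟨l, rfl⟩ := Nat.exists_eq_add_of_le (show k ≤ m by omega)
      rw [Nat.add_sub_cancel_left] at h1 ⊢
      rcases l with _ | l
      · rw [qPochCoeff_eq_zero _ (by omega)]
        simp only [add_zero, zero_add, qFac_succ, Finset.prod_range_succ _ k] at h1 ⊢
        linear_combination (q ^ 2) ^ (k + 1) * (1 - q ^ (2 * (k + 1))) * h1
      · have h2 := ih (k + 1) (by omega)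
        rw [show k + (l + 1) - (k + 1) = l by omega] at h2
        simp only [qFac_succ, Finset.prod_range_succ _ k] at h1 h2 ⊢
        linear_combination (1 - q ^ (2 * (l + 1))) * h2 +
          (q ^ 2) ^ (k + (l + 1) + 1) * (1 - q ^ (2 * (k + 1))) * h1

namespace SUqRel

theorem a_pow_c (h : SUqRel q a c) (i : ℕ) : a ^ i * c = (q : ℂ) ^ i • (c * a ^ i) := by
  induction i with
  | zero => simp
  | succ i ih =>
    rw [pow_succ', mul_assoc, ih, mul_smul_comm, h.a_c_mul, smul_smul, pow_succ]

/-- Noncommutative q-binomial expansion. Dividing by `∏ q^(i+1)` leaves `q^(k(k+1)/2)` times the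
Gaussian binomial. -/
theorem spherVec_eq_sum (h : SUqRel q a c) (hq : q ≠ 0) (w : ℂ) (m : ℕ) :
    spherVec q a c w m = ∑ k ∈ Finset.range (m + 1),
      (((qPochCoeff (q ^ 2) m k / ∏ i ∈ Finset.range k, q ^ (i + 1) : ℝ) : ℂ) * w ^ k) •
        (c ^ k * a ^ (m - k)) := by
  induction m with
  | zero => simp [spherVec, qPochCoeff]
  | succ m ih =>
    set E : ℕ → B := fun k =>
      (((qPochCoeff (q ^ 2) m k / ∏ i ∈ Finset.range k, q ^ (i + 1) : ℝ) : ℂ) * w ^ k) •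
        (c ^ k * a ^ (m + 1 - k)) with hE
    have h1 := Finset.sum_range_succ' E (m + 1)
    have h0 : E (m + 1) = 0 := by
      simp only [hE, qPochCoeff_eq_zero _ (Nat.lt_succ_self m), zero_div, Complex.ofReal_zero,
        zero_mul, zero_smul]
    rw [Finset.sum_range_succ, h0, add_zero] at h1
    have hl : spherVec q a c w m * a = ∑ k ∈ Finset.range (m + 1), E k := by
      rw [ih, Finset.sum_mul]
      refine Finset.sum_congr rfl fun k hk => ?_
      rw [Finset.mem_range] at hk
      simp only [hE]
      rw [smul_mul_assoc, mul_assoc, ← pow_succ, Nat.sub_add_comm (show k ≤ m by omega)]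
    rw [spherVec, mul_add, hl, h1, Finset.sum_range_succ' _ (m + 1), mul_smul_comm, ih,
      Finset.sum_mul, Finset.smul_sum, add_right_comm, ← Finset.sum_add_distrib]
    congr 1
    · refine Finset.sum_congr rfl fun k hk => ?_
      rw [Finset.mem_range] at hk
      obtain ⟨l, rfl⟩ := Nat.exists_eq_add_of_le (show k ≤ m by omega)
      simp only [hE]
      rw [smul_mul_assoc, mul_assoc, Nat.add_sub_cancel_left, h.a_pow_c, mul_smul_comm,
        ← mul_assoc, ← pow_succ, show k + l + 1 - (k + 1) = l by omega, smul_smul, smul_smul,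
        ← add_smul]
      congr 1
      have hp : ∏ i ∈ Finset.range k, (q : ℂ) ^ (i + 1) ≠ 0 :=
        Finset.prod_ne_zero_iff.2 fun i _ => pow_ne_zero _ (mod_cast hq)
      have hq' : (q : ℂ) ≠ 0 := mod_cast hq
      rw [qPochCoeff, Finset.prod_range_succ _ k]
      push_cast
      field_simp
      ring

end SUqRel

end

/-! ### The `q`-integral -/

section QIntegral

variable {r a b : ℝ} {f g : ℝ → ℂ}

theorem summable_qIntegral (hr0 : 0 ≤ r) (hr1 : r < 1) (hf : Continuous f) (a : ℝ) :
    Summable fun k : ℕ => f (a * r ^ k) * (r : ℂ) ^ k := by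
  obtain ⟨C, hC⟩ := (isCompact_uIcc (a := 0) (b := a)).exists_bound_of_continuousOn hf.continuousOn
  refine Summable.of_norm_bounded ((summable_geometric_of_lt_one hr0 hr1).mul_left C) fun k => ?_
  rw [norm_mul, norm_pow, Complex.norm_real, Real.norm_of_nonneg hr0]
  refine mul_le_mul_of_nonneg_right (hC _ ?_) (pow_nonneg hr0 k)
  have h0 := pow_nonneg hr0 k
  have h1 := pow_le_one₀ hr0 hr1.le (n := k)
  rw [Set.mem_uIcc]
  rcases le_total 0 a with ha | ha
  · left; constructor <;> nlinarith
  · right; constructor <;> nlinarith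

theorem norm_qIntegralZero_le (hr0 : 0 ≤ r) (hr1 : r < 1) {C : ℝ}
    (hf : ∀ k : ℕ, ‖f (a * r ^ k)‖ ≤ C) : ‖qIntegralZero r a f‖ ≤ |a| * C := by
  have h1 : ‖∑' k : ℕ, f (a * r ^ k) * (r : ℂ) ^ k‖ ≤ C * (1 - r)⁻¹ := by
    refine tsum_of_norm_bounded ((hasSum_geometric_of_lt_one hr0 hr1).mul_left C) fun k => ?_
    rw [norm_mul, norm_pow, Complex.norm_real, Real.norm_of_nonneg hr0]
    exact mul_le_mul_of_nonneg_right (hf k) (pow_nonneg hr0 k)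
  have h2 : ‖(1 - r : ℂ)‖ = 1 - r := by
    rw [← Complex.ofReal_one, ← Complex.ofReal_sub, Complex.norm_real,
      Real.norm_of_nonneg (by linarith)]
  rw [qIntegralZero, norm_mul, norm_mul, h2, Complex.norm_real, Real.norm_eq_abs]
  have h3 : 0 < 1 - r := by linarith
  calc (1 - r) * |a| * _ ≤ (1 - r) * |a| * (C * (1 - r)⁻¹) :=
        mul_le_mul_of_nonneg_left h1 (by positivity)
    _ = |a| * C := by field_simp

theorem qIntegralZero_add (hr0 : 0 ≤ r) (hr1 : r < 1) (hf : Continuous f) (hg : Continuous g) :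
    qIntegralZero r a (fun x => f x + g x) = qIntegralZero r a f + qIntegralZero r a g := by
  simp only [qIntegralZero, add_mul]
  rw [(summable_qIntegral hr0 hr1 hf a).tsum_add (summable_qIntegral hr0 hr1 hg a), mul_add]

theorem qIntegralZero_const_mul (z : ℂ) :
    qIntegralZero r a (fun x => z * f x) = z * qIntegralZero r a f := by
  simp only [qIntegralZero, mul_assoc]
  rw [tsum_mul_left]
  ring

theorem qIntegral_add (hr0 : 0 ≤ r) (hr1 : r < 1) (hf : Continuous f) (hg : Continuous g) :
    qIntegral r a b (fun x => f x + g x) = qIntegral r a b f + qIntegral r a b g := by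
  simp only [qIntegral, qIntegralZero_add hr0 hr1 hf hg]
  ring

theorem qIntegral_const_mul (z : ℂ) :
    qIntegral r a b (fun x => z * f x) = z * qIntegral r a b f := by
  simp only [qIntegral, qIntegralZero_const_mul, mul_sub]

/-- With `F(x) = (1 + x) P(x)` for `P` the given product, shifting the factors gives `F(rx) = (1 +
r^(m+1) x) P(x)`. Hence `F(x) - F(rx) = (1 - r^(m+1)) x P(x)`, and the series telescopes to `F(a) -
F(0)`. -/
theorem qIntegralZero_qPoch (hr0 : 0 ≤ r) (hr1 : r < 1) (a : ℝ) (m : ℕ) :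
    (1 - (r : ℂ) ^ (m + 1)) * qIntegralZero r a (fun x => (qPoch r m).eval (x : ℂ)) =
      (1 - r) * ((1 + a) * (qPoch r m).eval (a : ℂ) - 1) := by
  set F : ℝ → ℂ := fun x => (1 + x) * (qPoch r m).eval (x : ℂ) with hF
  have hP : Continuous fun x : ℝ => (qPoch r m).eval (x : ℂ) :=
    (qPoch r m).continuous.comp Complex.continuous_ofReal
  have hFc : Continuous F := (continuous_const.add Complex.continuous_ofReal).mul hP
  have hstep : ∀ x : ℝ, F (r * x) = (1 + (r : ℂ) ^ (m + 1) * x) * (qPoch r m).eval (x : ℂ) := by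
    intro x
    simp only [hF, qPoch, Polynomial.eval_prod, Polynomial.eval_add, Polynomial.eval_one,
      Polynomial.eval_mul, Polynomial.eval_C, Polynomial.eval_X]
    rw [mul_comm (1 + (r : ℂ) ^ (m + 1) * x), ← Finset.prod_range_succ
      (fun j => 1 + (r : ℂ) ^ (j + 1) * (x : ℂ)), Finset.prod_range_succ', mul_comm]
    push_cast
    congr 1
    · exact Finset.prod_congr rfl fun j _ => by ring
    · ring
  have h1 := ((summable_qIntegral hr0 hr1 hP a).mul_left
    ((1 - (r : ℂ) ^ (m + 1)) * a)).hasSum.tendsto_sum_nat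
  have h2 : ∀ n : ℕ, ∑ k ∈ Finset.range n, (1 - (r : ℂ) ^ (m + 1)) * a *
      ((qPoch r m).eval ((a * r ^ k : ℝ) : ℂ) * (r : ℂ) ^ k) = F a - F (a * r ^ n) := by
    intro n
    have := Finset.sum_range_sub' (fun k => F (a * r ^ k)) n
    rw [pow_zero, mul_one] at this
    rw [← this]
    refine Finset.sum_congr rfl fun k _ => ?_
    rw [show a * r ^ (k + 1) = r * (a * r ^ k) by ring, hstep]
    simp only [hF]
    push_cast
    ring
  simp only [h2] at h1
  have h3 : Filter.Tendsto (fun n : ℕ => F a - F (a * r ^ n)) Filter.atTop (nhds (F a - F 0)) := by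
    refine tendsto_const_nhds.sub ((hFc.tendsto 0).comp ?_)
    simpa using (tendsto_pow_atTop_nhds_zero_of_lt_one hr0 hr1).const_mul a
  have h4 := tendsto_nhds_unique h1 h3
  have h5 : F 0 = 1 := by
    simp [hF, qPoch, Polynomial.eval_prod]
  rw [tsum_mul_left, h5] at h4
  rw [qIntegralZero]
  linear_combination (1 - (r : ℂ)) * h4

end QIntegral

/-! ### The Haar functional on polynomials -/

theorem rhoInf_eq_spherElt {q : ℝ} (hq0 : 0 < q) (τ : ℝ) : rhoInf q τ =
    spherElt (suqAlpha q) (suqGamma q) (Complex.I * ((q ^ τ : ℝ) : ℂ)) := by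
  rw [rhoInf, spherElt, mul_pow, Complex.I_sq, mul_comm 2 τ, Real.rpow_mul hq0.le]
  congr 3
  push_cast
  rw [show ((2 : ℝ)) = ((2 : ℕ) : ℝ) by norm_num, Real.rpow_natCast]
  push_cast
  ring

theorem star_I_mul_ofReal (s : ℝ) : star (Complex.I * (s : ℂ)) = -(Complex.I * (s : ℂ)) := by
  rw [star_mul', RCLike.star_def, Complex.conj_I, Complex.conj_ofReal, neg_mul]

section

variable {q : ℝ} (hq0 : 0 < q) (hq1 : q < 1)

theorem haar_aeval_qPoch (s : ℝ) (m : ℕ) :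
    (1 - ((q ^ 2 : ℝ) : ℂ) ^ (m + 1)) * haar hq0 hq1 (Polynomial.aeval
      (spherElt (suqAlpha q) (suqGamma q) (Complex.I * (s : ℂ))) (qPoch (q ^ 2) m)) =
      (1 - ((q ^ 2 : ℝ) : ℂ)) * (qPoch (q ^ 2) m).eval ((s ^ 2 : ℝ) : ℂ) := by
  have hev : (qPoch (q ^ 2) m).eval ((s ^ 2 : ℝ) : ℂ) =
      ((∑ k ∈ Finset.range (m + 1), qPochCoeff (q ^ 2) m k * (s ^ 2) ^ k : ℝ) : ℂ) := by
    rw [← prod_eq_sum_qPochCoeff, qPoch, Polynomial.eval_prod]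
    push_cast
    simp
  rw [← (suq_rel q).spherVec_mul_star (star_I_mul_ofReal s), (suq_rel q).spherVec_eq_sum hq0.ne',
    star_sum, Finset.sum_mul, map_sum, hev, Complex.ofReal_sum, Finset.mul_sum, Finset.mul_sum]
  refine Finset.sum_congr rfl fun k hk => ?_
  -- Distinct monomials of degree `m` are orthogonal under `h`, so only the diagonal remains.
  rw [Finset.mul_sum, map_sum, Finset.sum_eq_single k]
  · rw [star_smul, smul_mul_smul_comm, map_smul, haar_monomial, if_pos ⟨rfl, rfl⟩, haarWeight,
      smul_eq_mul, star_mul', star_pow, star_I_mul_ofReal, RCLike.star_def, Complex.conj_ofReal]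
    rw [Finset.mem_range] at hk
    have h1 := qPochCoeff_mul_qFac (q := q) m k (by omega)
    rw [show k + (m - k) = m by omega, qFac_succ]
    have h2 : (Complex.I * (s : ℂ)) ^ k * (-(Complex.I * (s : ℂ))) ^ k = (((s ^ 2) ^ k : ℝ) : ℂ) := by
      rw [← mul_pow]
      push_cast
      congr 1
      linear_combination -(s : ℂ) ^ 2 * Complex.I_mul_I
    have h3 : (0 : ℝ) < ∏ i ∈ Finset.range k, q ^ (i + 1) := Finset.prod_pos fun i _ => by positivity
    set t := ∏ i ∈ Finset.range k, q ^ (i + 1)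
    have h4 := one_sub_pow_pos hq0 hq1 m
    have h5 := qFac_pos hq0 hq1 m
    -- One of the two coefficients cancels against the Haar weight by the Gaussian binomial formula;
    -- the other is the coefficient of `(s²)^k` in the polynomial on the right.
    have key : (1 - (q ^ 2) ^ (m + 1)) * (qPochCoeff (q ^ 2) m k / t * (qPochCoeff (q ^ 2) m k / t) *
        ((1 - q ^ 2) * qFac q k * qFac q (m - k) / (qFac q m * (1 - q ^ (2 * (m + 1)))))) =
        (1 - q ^ 2) * qPochCoeff (q ^ 2) m k := by
      rw [← pow_mul]
      field_simp
      linear_combination (1 - q ^ 2) * qPochCoeff (q ^ 2) m k * h1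
    have key' := congrArg (fun x : ℝ => (x : ℂ)) key
    push_cast at key' h2 ⊢
    linear_combination (s : ℂ) ^ (2 * k) * key' + (1 - ((q : ℂ) ^ 2) ^ (m + 1)) *
      ((qPochCoeff (q ^ 2) m k : ℂ) / t * ((qPochCoeff (q ^ 2) m k : ℂ) / t) *
        ((1 - (q : ℂ) ^ 2) * qFac q k * qFac q (m - k) /
          (qFac q m * (1 - (q : ℂ) ^ (2 * (m + 1)))))) * h2
  · intro l hl hkl
    rw [star_smul, smul_mul_smul_comm, map_smul, haar_monomial, if_neg (fun h => hkl h.1.symm),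
      smul_zero]
  · exact fun h => absurd hk h

/-- Consecutive products differ by `r^(m+1) X` times the earlier one, so the span is stable under
multiplication by `X`. -/
theorem span_qPoch {r : ℝ} (hr : r ≠ 0) (P : Polynomial ℂ) :
    P ∈ Submodule.span ℂ (Set.range (qPoch r)) := by
  have hX : ∀ x ∈ Submodule.span ℂ (Set.range (qPoch r)),
      x * Polynomial.X ∈ Submodule.span ℂ (Set.range (qPoch r)) := by
    intro x hx
    induction hx using Submodule.span_induction with
    | zero => rw [zero_mul]; exact zero_mem _
    | add x y _ _ hx hy => rw [add_mul]; exact add_mem hx hy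
    | smul z x _ hx => rw [smul_mul_assoc]; exact Submodule.smul_mem _ _ hx
    | mem x hx =>
      obtain ⟨m, rfl⟩ := hx
      have hr' : (r : ℂ) ^ (m + 1) ≠ 0 := pow_ne_zero _ (mod_cast hr)
      have : qPoch r m * Polynomial.X = ((r : ℂ) ^ (m + 1))⁻¹ • (qPoch r (m + 1) - qPoch r m) := by
        rw [eq_inv_smul_iff₀ hr', qPoch, qPoch, Finset.prod_range_succ, Polynomial.smul_eq_C_mul]
        ring
      rw [this]
      exact Submodule.smul_mem _ _ (sub_mem (Submodule.subset_span ⟨m + 1, rfl⟩)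
        (Submodule.subset_span ⟨m, rfl⟩))
  have hpow : ∀ n : ℕ, (Polynomial.X : Polynomial ℂ) ^ n ∈
      Submodule.span ℂ (Set.range (qPoch r)) := by
    intro n
    induction n with
    | zero => exact Submodule.subset_span ⟨0, by simp [qPoch]⟩
    | succ n ih => rw [pow_succ]; exact hX _ ih
  induction P using Polynomial.induction_on' with
  | add p q hp hq => exact add_mem hp hq
  | monomial n z =>
    rw [← Polynomial.C_mul_X_pow_eq_monomial, ← Polynomial.smul_eq_C_mul]
    exact Submodule.smul_mem _ _ (hpow n)

/-- Linearity reduces this to the products `qPoch`. The telescoped boundary value at `-1` loses its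
polynomial term through the factor `1 + x`, and the one at `s²` produces the factor `1 + s²`. -/
theorem haar_aeval_spherElt (s : ℝ) (P : Polynomial ℂ) :
    (1 + ((s ^ 2 : ℝ) : ℂ)) * haar hq0 hq1 (Polynomial.aeval
      (spherElt (suqAlpha q) (suqGamma q) (Complex.I * (s : ℂ))) P) =
      qIntegral (q ^ 2) (-1) (s ^ 2) (fun x => P.eval (x : ℂ)) := by
  have hr1 : q ^ 2 < 1 := by nlinarith
  have hcont : ∀ P : Polynomial ℂ, Continuous fun x : ℝ => P.eval (x : ℂ) := fun P =>
    P.continuous.comp Complex.continuous_ofReal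
  induction span_qPoch (r := q ^ 2) (by positivity) P using Submodule.span_induction with
  | zero => simp [qIntegral, qIntegralZero]
  | add P Q _ _ hP hQ =>
    simp only [Polynomial.eval_add]
    rw [qIntegral_add (sq_nonneg q) hr1 (hcont P) (hcont Q), map_add, map_add, mul_add, hP, hQ]
  | smul z P _ hP =>
    simp only [Polynomial.eval_smul, smul_eq_mul]
    rw [qIntegral_const_mul, map_smul, map_smul, smul_eq_mul, ← hP]
    ring
  | mem P hP =>
    obtain ⟨m, rfl⟩ := hP
    have h0 : (1 - ((q ^ 2 : ℝ) : ℂ) ^ (m + 1)) ≠ 0 := by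
      have := one_sub_pow_pos hq0 hq1 m
      rw [pow_mul] at this
      exact_mod_cast this.ne'
    have h1 := haar_aeval_qPoch hq0 hq1 s m
    have h2 := qIntegralZero_qPoch (sq_nonneg q) hr1 (s ^ 2) m
    have h3 := qIntegralZero_qPoch (sq_nonneg q) hr1 (-1) m
    refine mul_left_cancel₀ h0 ?_
    rw [qIntegral, mul_sub, h2, h3]
    push_cast at h1 ⊢
    linear_combination (1 + (s : ℂ) ^ 2) * h1

end

/-! ### The spectrum of the spherical element -/

theorem nonneg_of_mem_spectrum_star_mul_self {B : Type*} [CStarAlgebra B] {b : B} {z : ℂ}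
    (hz : z ∈ spectrum ℂ (star b * b)) : 0 ≤ z.re := by
  refine spectrum_star_mul_self_nonneg (b := b) z.re ?_
  have := (IsSelfAdjoint.star_mul_self b).mem_spectrum_eq_re hz
  rw [this] at hz
  exact spectrum.of_algebraMap_mem ℂ hz

theorem mem_spectrum_algebraMap_sub {B : Type*} [CStarAlgebra B] {b : B} {z r : ℂ} :
    r - z ∈ spectrum ℂ (algebraMap ℂ B r - b) ↔ z ∈ spectrum ℂ b := by
  rw [← spectrum.singleton_sub_eq]
  simp

theorem mem_spectrum_one_add {B : Type*} [CStarAlgebra B] {b : B} {z : ℂ} :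
    1 + z ∈ spectrum ℂ (1 + b) ↔ z ∈ spectrum ℂ b := by
  rw [← map_one (algebraMap ℂ B), ← spectrum.singleton_add_eq]
  simp

namespace SUqRel

variable {B : Type*} [CStarAlgebra B] {q : ℝ} {a c : B}

theorem isSelfAdjoint_spherElt (h : SUqRel q a c) {w : ℂ} (hw : star w = -w) :
    IsSelfAdjoint (spherElt a c w) := by
  rw [← add_sub_cancel_left 1 (spherElt a c w), ← h.one_add_spherElt hw]
  exact (IsSelfAdjoint.star_mul_self _).sub (.one B)

theorem re_mem_Icc_of_mem_spectrum (h : SUqRel q a c) {s : ℝ} {z : ℂ}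
    (hz : z ∈ spectrum ℂ (spherElt a c (Complex.I * s))) : z.re ∈ Set.Icc (-1) (s ^ 2) := by
  have hw := star_I_mul_ofReal s
  have h1 := mem_spectrum_one_add.2 hz
  have h2 := (mem_spectrum_algebraMap_sub (r := -(Complex.I * (s : ℂ)) ^ 2)).2 hz
  rw [← h.one_add_spherElt hw] at h1
  rw [← h.neg_sq_sub_spherElt hw] at h2
  have h1' := nonneg_of_mem_spectrum_star_mul_self h1
  have h2' := nonneg_of_mem_spectrum_star_mul_self h2
  rw [mul_pow, Complex.I_sq, neg_one_mul, neg_neg, ← Complex.ofReal_pow, Complex.sub_re,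
    Complex.ofReal_re] at h2'
  rw [Complex.add_re, Complex.one_re] at h1'
  constructor <;> linarith

/-- Away from `0`, `b⋆b` and `bb⋆` have the same spectrum. For `b = c + w a` this moves `z` from
`ρ_w` to `ρ_(qw)`; for `b = a + q w c` it moves `z` on to `q² ρ_w`. The two excluded values are
where the point to be moved is `0`. -/
theorem div_mem_spectrum (h : SUqRel q a c) (hq : q ≠ 0) {w : ℂ} (hw : star w = -w) {z : ℂ}
    (hz : z ∈ spectrum ℂ (spherElt a c w)) (h1 : z ≠ -w ^ 2) (h2 : z ≠ -1) :
    z / (q : ℂ) ^ 2 ∈ spectrum ℂ (spherElt a c w) := by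
  have hq' : (q : ℂ) ^ 2 ≠ 0 := pow_ne_zero 2 (mod_cast hq)
  have e1 : -w ^ 2 - z ∈ spectrum ℂ (star (c + w • a) * (c + w • a)) \ {0} := by
    refine ⟨?_, fun hh => h1 (sub_eq_zero.1 hh).symm⟩
    rw [h.neg_sq_sub_spherElt hw]
    exact mem_spectrum_algebraMap_sub.2 hz
  rw [spectrum.nonzero_mul_comm, h.neg_sq_sub_spherElt' hw] at e1
  have e2 := mem_spectrum_algebraMap_sub.1 e1.1
  have hqw : star ((q : ℂ) * w) = -((q : ℂ) * w) := by
    simpa using star_ofReal_pow_mul hw q 1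
  have e3 : 1 + z ∈ spectrum ℂ (star (a + ((q : ℂ) * w) • c) * (a + ((q : ℂ) * w) • c)) \ {0} := by
    refine ⟨?_, fun hh => h2 (eq_neg_of_add_eq_zero_right hh)⟩
    rw [h.one_add_spherElt hqw]
    exact mem_spectrum_one_add.2 e2
  rw [spectrum.nonzero_mul_comm, h.one_add_smul_spherElt hw] at e3
  have e4 := mem_spectrum_one_add.1 e3.1
  refine (spectrum.smul_mem_smul_iff (r := Units.mk0 _ hq')).1 ?_
  simpa [Units.smul_def, mul_div_cancel₀ z hq'] using e4

theorem spectrum_subset (h : SUqRel q a c) (hq0 : 0 < q) (hq1 : q < 1) {s : ℝ} {z : ℂ}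
    (hz : z ∈ spectrum ℂ (spherElt a c (Complex.I * s))) :
    (∃ k : ℕ, z.re = -(q ^ 2) ^ k) ∨ (∃ k : ℕ, z.re = s ^ 2 * (q ^ 2) ^ k) ∨ z.re = 0 := by
  by_contra! hcon
  obtain ⟨c1, c2, c3⟩ := hcon
  have hq' : (q : ℂ) ^ 2 ≠ 0 := pow_ne_zero 2 (mod_cast hq0.ne')
  have hr0 : 0 < q ^ 2 := by positivity
  have hw := star_I_mul_ofReal s
  have hws : -(Complex.I * (s : ℂ)) ^ 2 = ((s ^ 2 : ℝ) : ℂ) := by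
    rw [mul_pow, Complex.I_sq]; push_cast; ring
  have hre := (h.isSelfAdjoint_spherElt hw).mem_spectrum_eq_re hz
  have hiter : ∀ n : ℕ, z / ((q : ℂ) ^ 2) ^ n ∈ spectrum ℂ (spherElt a c (Complex.I * s)) := by
    intro n
    induction n with
    | zero => simpa using hz
    | succ n ih =>
      rw [pow_succ, ← div_div]
      have hn : ((q : ℂ) ^ 2) ^ n ≠ 0 := pow_ne_zero n hq'
      refine h.div_mem_spectrum hq0.ne' hw ih (fun hh => c2 n ?_) (fun hh => c1 n ?_)
      · rw [hws, div_eq_iff hn, hre] at hh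
        exact_mod_cast hh
      · rw [div_eq_iff hn, hre] at hh
        rw [neg_one_mul] at hh
        exact_mod_cast hh
  -- All the quotients `z / q^(2n)` lie in `[-1, s²]`, which is impossible for nonzero `z` as `n`
  -- grows.
  have hbd : ∀ n : ℕ, |z.re| * ((q ^ 2)⁻¹) ^ n ≤ 1 + s ^ 2 := by
    intro n
    have := h.re_mem_Icc_of_mem_spectrum (hiter n)
    have e : (z / ((q : ℂ) ^ 2) ^ n).re = z.re * ((q ^ 2)⁻¹) ^ n := by
      rw [hre, ← Complex.ofReal_pow, ← Complex.ofReal_pow, ← Complex.ofReal_div, Complex.ofReal_re,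
        Complex.ofReal_re, inv_pow, div_eq_mul_inv]
    rw [e] at this
    rw [← abs_of_pos (show 0 < ((q ^ 2)⁻¹) ^ n by positivity), ← abs_mul, abs_le]
    have h0 := sq_nonneg s
    constructor <;> linarith [this.1, this.2]
  have ht := (tendsto_pow_atTop_atTop_of_one_lt
    (one_lt_inv_iff₀.2 ⟨hr0, by nlinarith⟩ : 1 < (q ^ 2)⁻¹)).const_mul_atTop (abs_pos.2 c3)
  obtain ⟨n, hn⟩ := (ht.eventually_gt_atTop (1 + s ^ 2)).exists
  exact absurd (hbd n) (not_le.2 hn)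

end SUqRel

/-! ### The Haar functional on continuous functions of the spherical element -/

theorem exists_complex_polynomial_near {l u : ℝ} {f : ℝ → ℂ} (hf : Continuous f) {ε : ℝ}
    (hε : 0 < ε) : ∃ P : Polynomial ℂ, ∀ x ∈ Set.Icc l u, ‖P.eval (x : ℂ) - f x‖ ≤ ε := by
  obtain ⟨P, hP⟩ := exists_polynomial_near_of_continuousOn l u (fun x => (f x).re)
    (Complex.continuous_re.comp hf).continuousOn (ε / 2) (half_pos hε)
  obtain ⟨Q, hQ⟩ := exists_polynomial_near_of_continuousOn l u (fun x => (f x).im)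
    (Complex.continuous_im.comp hf).continuousOn (ε / 2) (half_pos hε)
  refine ⟨P.map Complex.ofRealHom + Polynomial.C Complex.I * Q.map Complex.ofRealHom,
    fun x hx => ?_⟩
  have hev : ∀ R : Polynomial ℝ, (R.map Complex.ofRealHom).eval (x : ℂ) = ((R.eval x : ℝ) : ℂ) :=
    fun R => by
      rw [Polynomial.eval_map]
      exact Polynomial.eval₂_at_apply Complex.ofRealHom x
  rw [Polynomial.eval_add, Polynomial.eval_mul, Polynomial.eval_C, hev, hev]
  refine (Complex.norm_le_abs_re_add_abs_im _).trans ?_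
  have h1 := hP x hx
  have h2 := hQ x hx
  simp only [Complex.sub_re, Complex.add_re, Complex.ofReal_re, Complex.mul_re, Complex.I_re,
    Complex.I_im, Complex.ofReal_im, Complex.sub_im, Complex.add_im, Complex.mul_im]
  ring_nf at h1 h2 ⊢
  linarith

theorem norm_qIntegral_le {r a b : ℝ} {f : ℝ → ℂ} (hr0 : 0 ≤ r) (hr1 : r < 1) {C : ℝ}
    (ha : ∀ k : ℕ, ‖f (a * r ^ k)‖ ≤ C) (hb : ∀ k : ℕ, ‖f (b * r ^ k)‖ ≤ C) :
    ‖qIntegral r a b f‖ ≤ (|b| + |a|) * C := by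
  rw [qIntegral, add_mul]
  exact (norm_sub_le _ _).trans
    (add_le_add (norm_qIntegralZero_le hr0 hr1 hb) (norm_qIntegralZero_le hr0 hr1 ha))

section

variable {q : ℝ} (hq0 : 0 < q) (hq1 : q < 1)

theorem haar_funcAt (s : ℝ) {p : ℝ → ℂ} (hp : Continuous p) :
    (1 + ((s ^ 2 : ℝ) : ℂ)) * haar hq0 hq1
      (funcAt p (spherElt (suqAlpha q) (suqGamma q) (Complex.I * (s : ℂ)))) =
      qIntegral (q ^ 2) (-1) (s ^ 2) p := by
  set ρ := spherElt (suqAlpha q) (suqGamma q) (Complex.I * (s : ℂ)) with hρ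
  have hr0 : (0 : ℝ) ≤ q ^ 2 := sq_nonneg q
  have hr1 : q ^ 2 < 1 := by nlinarith
  have hsa : IsSelfAdjoint ρ := (suq_rel q).isSelfAdjoint_spherElt (star_I_mul_ofReal s)
  have hn : IsStarNormal ρ := hsa.isStarNormal
  have hs := sq_nonneg s
  have hb : ∀ k : ℕ, s ^ 2 * (q ^ 2) ^ k ∈ Set.Icc (-1) (s ^ 2) := fun k =>
    have h0 := pow_nonneg hr0 k
    have h1 := pow_le_one₀ hr0 hr1.le (n := k)
    ⟨by nlinarith, by nlinarith⟩
  have ha : ∀ k : ℕ, -1 * (q ^ 2) ^ k ∈ Set.Icc (-1) (s ^ 2) := fun k =>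
    have h0 := pow_nonneg hr0 k
    have h1 := pow_le_one₀ hr0 hr1.le (n := k)
    ⟨by nlinarith, by nlinarith⟩
  -- `K` bounds how far the two sides together can change when `p` changes by at most one on `[-1,
  -- s²]`.
  set K := (1 + s ^ 2) * ‖haar hq0 hq1‖ + (|s ^ 2| + |-1|) with hK
  have hK0 : 0 < K := by
    have : 0 < |s ^ 2| + |(-1 : ℝ)| := by positivity
    have : 0 ≤ (1 + s ^ 2) * ‖haar hq0 hq1‖ := by positivity
    linarith
  rw [← sub_eq_zero, ← norm_le_zero_iff]
  refine le_of_forall_pos_le_add fun ε hε => ?_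
  obtain ⟨P, hP⟩ := exists_complex_polynomial_near (l := -1) (u := s ^ 2) hp (div_pos hε hK0)
  have hPc : Continuous fun x : ℝ => P.eval (x : ℂ) := P.continuous.comp Complex.continuous_ofReal
  have h1 : ‖Polynomial.aeval ρ P - funcAt p ρ‖ ≤ ε / K := by
    have hpc : Continuous fun z : ℂ => p z.re := hp.comp Complex.continuous_re
    rw [← cfc_polynomial P ρ, funcAt, ← cfc_sub _ _ ρ P.continuous.continuousOn hpc.continuousOn]
    refine norm_cfc_le (by positivity) fun z hz => ?_
    rw [hsa.mem_spectrum_eq_re hz, Complex.ofReal_re]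
    exact hP _ ((suq_rel q).re_mem_Icc_of_mem_spectrum hz)
  have h2 : ‖qIntegral (q ^ 2) (-1) (s ^ 2) (fun x => P.eval (x : ℂ) + -1 * p x)‖ ≤
      (|s ^ 2| + |-1|) * (ε / K) := by
    simp only [neg_one_mul (p _), ← sub_eq_add_neg]
    exact norm_qIntegral_le hr0 hr1 (fun k => hP _ (ha k)) fun k => hP _ (hb k)
  have hp' : Continuous fun x => -1 * p x := continuous_const.mul hp
  rw [qIntegral_add hr0 hr1 hPc hp', qIntegral_const_mul,
    ← haar_aeval_spherElt hq0 hq1 s P] at h2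
  have h3 : ‖(1 + ((s ^ 2 : ℝ) : ℂ)) * haar hq0 hq1 (Polynomial.aeval ρ P - funcAt p ρ)‖ ≤
      (1 + s ^ 2) * (‖haar hq0 hq1‖ * (ε / K)) := by
    rw [norm_mul, ← Complex.ofReal_one, ← Complex.ofReal_add, Complex.norm_real,
      Real.norm_of_nonneg (by positivity)]
    exact mul_le_mul_of_nonneg_left ((ContinuousLinearMap.le_opNorm _ _).trans
      (mul_le_mul_of_nonneg_left h1 (norm_nonneg _))) (by positivity)
  have h4 : (1 + ((s ^ 2 : ℝ) : ℂ)) * haar hq0 hq1 (funcAt p ρ) - qIntegral (q ^ 2) (-1) (s ^ 2) p =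
      ((1 + ((s ^ 2 : ℝ) : ℂ)) * haar hq0 hq1 (Polynomial.aeval ρ P) +
        -1 * qIntegral (q ^ 2) (-1) (s ^ 2) p) -
      (1 + ((s ^ 2 : ℝ) : ℂ)) * haar hq0 hq1 (Polynomial.aeval ρ P - funcAt p ρ) := by
    rw [map_sub]; ring
  rw [h4, zero_add]
  refine (norm_sub_le _ _).trans ((add_le_add h2 h3).trans (le_of_eq ?_))
  rw [show (|s ^ 2| + |-1|) * (ε / K) + (1 + s ^ 2) * (‖haar hq0 hq1‖ * (ε / K)) = K * (ε / K) by
    rw [hK]; ring, mul_div_cancel₀ _ hK0.ne']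

end

theorem mem_rhoSet_iff {q : ℝ} (hq0 : 0 < q) (τ x : ℝ) : x ∈ rhoSet q τ ↔
    (∃ k : ℕ, x = -(q ^ 2) ^ k) ∨ (∃ k : ℕ, x = (q ^ τ) ^ 2 * (q ^ 2) ^ k) ∨ x = 0 := by
  have h : ∀ k : ℕ, q ^ (2 * τ + 2 * (k : ℝ)) = (q ^ τ) ^ 2 * (q ^ 2) ^ k := fun k => by
    rw [Real.rpow_add hq0, mul_comm 2 τ, Real.rpow_mul hq0.le, Real.rpow_mul hq0.le,
      Real.rpow_natCast, Real.rpow_two, Real.rpow_two]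
  simp only [rhoSet, Set.mem_union, Set.mem_range, Set.mem_singleton_iff, h, pow_mul, or_assoc,
    eq_comm]

/-- With lower limit `-1` the subtracted integral contributes with a positive sign, so the
q-integral is a sum over point masses, all strictly positive. -/
theorem qIntegral_ofReal_eq_zero {r b : ℝ} (hr0 : 0 < r) (hr1 : r < 1) (hb : 0 < b) {f : ℝ → ℝ}
    (hf : Continuous f) (hf0 : ∀ x, 0 ≤ f x)
    (h : qIntegral r (-1) b (fun x => (f x : ℂ)) = 0) (k : ℕ) :
    f (-r ^ k) = 0 ∧ f (b * r ^ k) = 0 := by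
  have hs : ∀ a, Summable fun k : ℕ => f (a * r ^ k) * r ^ k := fun a => by
    have := summable_qIntegral hr0.le hr1 (Complex.continuous_ofReal.comp hf) a
    simp only [Function.comp_apply, ← Complex.ofReal_pow, ← Complex.ofReal_mul] at this
    exact Complex.summable_ofReal.1 this
  have h0 : ∀ a (k : ℕ), 0 ≤ f (a * r ^ k) * r ^ k := fun a k =>
    mul_nonneg (hf0 _) (pow_nonneg hr0.le k)
  have hz : ∀ a, qIntegralZero r a (fun x => (f x : ℂ)) =
      (((1 - r) * a * ∑' k : ℕ, f (a * r ^ k) * r ^ k : ℝ) : ℂ) := fun a => by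
    rw [qIntegralZero]
    push_cast
    rfl
  have hp : ∀ a, 0 ≤ ∑' k : ℕ, f (a * r ^ k) * r ^ k := fun a => tsum_nonneg (h0 a)
  rw [qIntegral, hz, hz, ← Complex.ofReal_sub, Complex.ofReal_eq_zero] at h
  have h1 : b * ∑' k : ℕ, f (b * r ^ k) * r ^ k + ∑' k : ℕ, f (-1 * r ^ k) * r ^ k = 0 := by
    have : (1 - r) ≠ 0 := by linarith
    refine mul_left_cancel₀ this ?_
    linear_combination h
  have h2 := hp b
  have h3 := hp (-1)
  have h4 : ∑' k : ℕ, f (-1 * r ^ k) * r ^ k ≤ 0 := by nlinarith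
  have h5 : ∑' k : ℕ, f (b * r ^ k) * r ^ k ≤ 0 := by
    by_contra! h6
    have := mul_pos hb h6
    linarith
  have key : ∀ a, ∑' k : ℕ, f (a * r ^ k) * r ^ k ≤ 0 → f (a * r ^ k) = 0 := fun a ha => by
    have h6 := ((hs a).le_tsum k fun j _ => h0 a j).trans ha
    have h7 := le_antisymm h6 (h0 a k)
    exact (mul_eq_zero.1 h7).resolve_right (pow_pos hr0 k).ne'
  exact ⟨by simpa using key (-1) h4, key b h5⟩

theorem spectrum_spherElt {q : ℝ} (hq0 : 0 < q) (hq1 : q < 1) {s : ℝ} (hs : 0 < s) :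
    spectrum ℂ (spherElt (suqAlpha q) (suqGamma q) (Complex.I * (s : ℂ))) =
      (fun x : ℝ => (x : ℂ)) '' {x : ℝ | (∃ k : ℕ, x = -(q ^ 2) ^ k) ∨
        (∃ k : ℕ, x = s ^ 2 * (q ^ 2) ^ k) ∨ x = 0} := by
  set ρ := spherElt (suqAlpha q) (suqGamma q) (Complex.I * (s : ℂ)) with hρ
  have hr0 : 0 < q ^ 2 := by positivity
  have hr1 : q ^ 2 < 1 := by nlinarith
  have hsa : IsSelfAdjoint ρ := (suq_rel q).isSelfAdjoint_spherElt (star_I_mul_ofReal s)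
  have hcl : IsClosed {x : ℝ | (x : ℂ) ∈ spectrum ℂ ρ} :=
    (spectrum.isClosed ρ).preimage Complex.continuous_ofReal
  have hpt : ∀ k : ℕ, ∀ x : ℝ, x = -(q ^ 2) ^ k ∨ x = s ^ 2 * (q ^ 2) ^ k →
      (x : ℂ) ∈ spectrum ℂ ρ := by
    intro k x hx
    by_contra hcon
    obtain ⟨δ, hδ, hball⟩ := Metric.isOpen_iff.1 hcl.isOpen_compl x hcon
    -- A bump at `x` supported off the spectrum: its functional calculus is `0`, yet its q-integral
    -- sees the mass at `x`.
    have hfc : Continuous fun y : ℝ => max 0 (1 - |y - x| / δ) := by fun_prop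
    have h1 := haar_funcAt hq0 hq1 s (Complex.continuous_ofReal.comp hfc)
    have h2 : funcAt (Complex.ofReal ∘ fun y : ℝ => max 0 (1 - |y - x| / δ)) ρ = 0 := by
      rw [funcAt, ← norm_le_zero_iff]
      refine norm_cfc_le le_rfl fun z hz => ?_
      have h3 : z.re ∉ Metric.ball x δ := fun hh => hball hh (by
        rw [Set.mem_ofPred_eq, ← hsa.mem_spectrum_eq_re hz]
        exact hz)
      rw [Metric.mem_ball, Real.dist_eq, not_lt, ← one_le_div hδ] at h3
      rw [Function.comp_apply, max_eq_left (by linarith), Complex.ofReal_zero, norm_zero]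
    rw [h2, map_zero, mul_zero] at h1
    have h4 := qIntegral_ofReal_eq_zero hr0 hr1 (by positivity) hfc
      (fun y => le_max_left _ _) h1.symm k
    have h5 : max 0 (1 - |x - x| / δ) = 1 := by simp
    rcases hx with hx | hx
    · rw [← hx, h5] at h4; exact one_ne_zero h4.1
    · rw [← hx, h5] at h4; exact one_ne_zero h4.2
  ext z
  constructor
  · intro hz
    exact ⟨z.re, (suq_rel q).spectrum_subset hq0 hq1 hz, (hsa.mem_spectrum_eq_re hz).symm⟩
  · rintro ⟨x, ⟨k, hk⟩ | ⟨k, hk⟩ | rfl, rfl⟩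
    · exact hpt k x (Or.inl hk)
    · exact hpt k x (Or.inr hk)
    · have ht : Filter.Tendsto (fun k : ℕ => -(q ^ 2) ^ k) Filter.atTop (nhds 0) := by
        simpa using (tendsto_pow_atTop_nhds_zero_of_lt_one hr0.le hr1).neg
      have h0 : (0 : ℝ) ∈ {x : ℝ | (x : ℂ) ∈ spectrum ℂ ρ} :=
        hcl.mem_of_tendsto ht (Filter.Eventually.of_forall fun k => hpt k _ (Or.inl rfl))
      exact h0

theorem qIntegral_congr {r a b : ℝ} {f g : ℝ → ℂ} (ha : ∀ k : ℕ, f (a * r ^ k) = g (a * r ^ k))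
    (hb : ∀ k : ℕ, f (b * r ^ k) = g (b * r ^ k)) : qIntegral r a b f = qIntegral r a b g := by
  simp only [qIntegral, qIntegralZero, ha, hb]

theorem theorem5p1 (q τ : ℝ) (hq0 : 0 < q) (hq1 : q < 1) :
    (∃! h : ASU q →L[ℂ] ℂ, IsHaarFunctional q h) ∧
    IsSelfAdjoint (rhoInf q τ) ∧
    spectrum ℂ (rhoInf q τ) = (fun x : ℝ => (x : ℂ)) '' rhoSet q τ ∧
    (StarAlgebra.elemental ℂ (rhoInf q τ) : Set (ASU q)) =
      {a | ∃ p : ℝ → ℂ, ContinuousOn p (rhoSet q τ) ∧ funcAt p (rhoInf q τ) = a} ∧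
    ∀ h : ASU q →L[ℂ] ℂ, IsHaarFunctional q h →
      ∀ p : ℝ → ℂ, ContinuousOn p (rhoSet q τ) →
        QIntegrable (q ^ 2) (-1) (q ^ (2 * τ)) p ∧
        h (funcAt p (rhoInf q τ)) =
          (((1 + q ^ (2 * τ))⁻¹ : ℝ) : ℂ) * qIntegral (q ^ 2) (-1) (q ^ (2 * τ)) p := by
  have hs : 0 < q ^ τ := Real.rpow_pos_of_pos hq0 τ
  have hr1 : q ^ 2 < 1 := by nlinarith
  have hb : q ^ (2 * τ) = (q ^ τ) ^ 2 := by
    rw [mul_comm 2 τ, Real.rpow_mul hq0.le, Real.rpow_two]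
  have hsa : IsSelfAdjoint (rhoInf q τ) := by
    rw [rhoInf_eq_spherElt hq0]
    exact (suq_rel q).isSelfAdjoint_spherElt (star_I_mul_ofReal _)
  have hn : IsStarNormal (rhoInf q τ) := hsa.isStarNormal
  have hspec : spectrum ℂ (rhoInf q τ) = (fun x : ℝ => (x : ℂ)) '' rhoSet q τ := by
    rw [rhoInf_eq_spherElt hq0, spectrum_spherElt hq0 hq1 hs]
    congr 1
    ext x
    exact (mem_rhoSet_iff hq0 τ x).symm
  have hcl : IsClosed (rhoSet q τ) := by
    have : rhoSet q τ = Complex.ofReal ⁻¹' spectrum ℂ (rhoInf q τ) := by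
      rw [hspec]
      exact (Set.preimage_image_eq _ Complex.ofReal_injective).symm
    rw [this]
    exact (spectrum.isClosed _).preimage Complex.continuous_ofReal
  refine ⟨⟨haar hq0 hq1, isHaarFunctional_haar hq0 hq1, fun h hh => hh.eq_haar hq0 hq1⟩, hsa, hspec,
    ?_, ?_⟩
  · ext x
    constructor
    · intro hx
      rw [← range_cfc ℂ hn] at hx
      obtain ⟨f, rfl⟩ := hx
      by_cases hf : ContinuousOn f (spectrum ℂ (rhoInf q τ))
      · refine ⟨fun x => f x, hf.comp Complex.continuous_ofReal.continuousOn fun x hx => ?_, ?_⟩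
        · rw [hspec]; exact ⟨x, hx, rfl⟩
        · refine cfc_congr fun z hz => ?_
          change f (z.re : ℂ) = f z
          rw [← hsa.mem_spectrum_eq_re hz]
      -- For a function not continuous on the spectrum `cfc` takes the default value `0`, which the
      -- zero function also represents.
      · refine ⟨fun _ => 0, continuousOn_const, ?_⟩
        change funcAt (fun _ => 0) _ = cfc f _
        rw [cfc_apply_of_not_continuousOn _ hf, funcAt, cfc_const_zero]
    · rintro ⟨p, -, rfl⟩
      exact cfc_mem_elemental _ _
  · intro h hh p hp
    obtain rfl := hh.eq_haar hq0 hq1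
    -- Tietze extension from the closed set `rhoSet`. Neither the functional calculus nor the
    -- q-integral sees values off this set, so `p` may be replaced by the globally continuous `g`.
    obtain ⟨g, hg⟩ := ContinuousMap.exists_restrict_eq hcl ⟨_, hp.domRestrict⟩
    have hgp : ∀ x ∈ rhoSet q τ, g x = p x := fun x hx => DFunLike.congr_fun hg ⟨x, hx⟩
    have h1 : ∀ k : ℕ, g (-1 * (q ^ 2) ^ k) = p (-1 * (q ^ 2) ^ k) := fun k =>
      hgp _ ((mem_rhoSet_iff hq0 τ _).2 (Or.inl ⟨k, neg_one_mul _⟩))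
    have h2 : ∀ k : ℕ, g (q ^ (2 * τ) * (q ^ 2) ^ k) = p (q ^ (2 * τ) * (q ^ 2) ^ k) := fun k =>
      hgp _ ((mem_rhoSet_iff hq0 τ _).2 (Or.inr (Or.inl ⟨k, by rw [hb]⟩)))
    have h3 : funcAt p (rhoInf q τ) = funcAt g (rhoInf q τ) := cfc_congr fun z hz => by
      rw [hspec] at hz
      obtain ⟨x, hx, rfl⟩ := hz
      exact (hgp x hx).symm
    have h4 := haar_funcAt hq0 hq1 (q ^ τ) g.continuous
    rw [← rhoInf_eq_spherElt hq0, ← hb] at h4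
    refine ⟨⟨?_, ?_⟩, ?_⟩
    · simpa only [h1] using summable_qIntegral (sq_nonneg q) hr1 g.continuous (-1)
    · simpa only [h2] using summable_qIntegral (sq_nonneg q) hr1 g.continuous (q ^ (2 * τ))
    · rw [h3, ← qIntegral_congr h1 h2, ← h4]
      have h5 : (1 + ((q ^ (2 * τ) : ℝ) : ℂ)) ≠ 0 := by
        have : 0 < 1 + q ^ (2 * τ) := by rw [hb]; positivity
        exact_mod_cast this.ne'
      rw [Complex.ofReal_inv, Complex.ofReal_add, Complex.ofReal_one, inv_mul_cancel_left₀ h5]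

end
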